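/- **Setting.** Let $n\ge 0$ be an integer and let $\{\xi(m)\}_{m\in\mathbb Z}$ be a complex-valued stochastic sequence with increments $$\xi^{(n)}(m,\mu)=\sum_{l=0}^{n}(-1)^l\binom nl\,\xi(m-l\mu),\qquad m,\mu\in\mathbb Z .$$ Assume that $\xi$ has wide-sense stationary $n$-th increments of mean zero, that is, all $\xi^{(n)}(m,\mu)$ lie in $L_2(\Omega,P)$, $\mathsf E\,\xi^{(n)}(m,\mu)=0$, and $\mathsf E\,\xi^{(n)}(m_0+m,\mu_1)\overline{\xi^{(n)}(m_0,\mu_2)}$ does not depend on $m_0$. For a family $X(m,\mu)$, $m,\mu\in\mathbb Z$, in $L_2(\Omega,P)$ let $H^t(X)$ be the closed linear span of $\{X(k,\nu):k\le t,\ \nu>0\}$. Put $S=\bigcap_t H^t(\xi^{(n)})$, let $\xi^{(n)}_s(m,\mu)$ (singular component) be the orthogonal projection of $\xi^{(n)}(m,\mu)$ to $S$, and let $\xi^{(n)}_r=\xi^{(n)}-\xi^{(n)}_s$ (regular component). Assume: (a) There are an innovation sequence $\{\varepsilon_m\}_{m\in\mathbb Z}$ of $\xi^{(n)}_r$ (that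 is, $\mathsf E\varepsilon_m=0$, $\mathsf E\varepsilon_m\overline{\varepsilon_k}=\delta_{mk}$, and $H^t(\xi^{(n)}_r)$ is the closed linear span of $\{\varepsilon_k:k\le t\}$ for every $t$) and square summable sequences $\{\varphi_\mu(k)\}_{k\ge0}$, $\mu>0$, such that, in $L_2(\Omega,P)$, $$\xi^{(n)}_r(m,\mu)=\sum_{k=0}^\infty\varphi_\mu(k)\,\varepsilon_{m-k},\qquad m\in\mathbb Z,\ \mu>0 .$$ (b) $\xi^{(n)}_r$ has a spectral density $f\ge 0$ (measurable and integrable on $[-\pi,\pi)$), that is, with $dF(\lambda)=\frac1{2\pi}f(\lambda)\,d\lambda$, for all integers $m_0,m,\mu_1,\mu_2$, $$\mathsf E\,\xi^{(n)}_r(m_0+m,\mu_1)\overline{\xi^{(n)}_r(m_0,\mu_2)}=\int_{-\pi}^{\pi}e^{i\lambda m}(1-e^{-i\mu_1\lambda})^n(1-e^{i\mu_2\lambda})^n\frac1{\lambda^{2n}}\,dF(\lambda).$$ Let $\Phi_\mu(e^{-i\lambda})=\sum_{k=0}^\infty\varphi_\mu(k)e^{-i\lambda k}$ (convergence in $L_2(-\pi,\pi)$).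 **Statement.** There is an orthogonal stochastic measure $Z$ on $[-\pi,\pi)$ with values in $L_2(\Omega,P)$, $\mathsf E Z(A)\overline{Z(B)}=F(A\cap B)$, such that $$\xi^{(n)}_r(m,\mu)=\int_{-\pi}^{\pi}e^{i\lambda m}(1-e^{-i\mu\lambda})^n\frac1{(i\lambda)^n}\,dZ(\lambda)\qquad\text{for all } m,\mu\in\mathbb Z .$$ For every such $Z$ and all integers $m\ge0$, $\mu>0$: $\Phi_\mu(e^{-i\lambda})\ne0$ for almost every $\lambda$, and the unique optimal mean square linear estimate of $\xi^{(n)}(m,\mu)$ from the observed increments, that is, the unique element $\hat\xi^{(n)}(m,\mu)$ of $H^{-1}(\xi^{(n)})$ at minimal mean square distance from $\xi^{(n)}(m,\mu)$, is $$\hat\xi^{(n)}(m,\mu)=\xi_s^{(n)}(m,\mu)+\int_{-\pi}^{\pi}h_{m,\mu}(\lambda)(1-e^{-i\lambda\mu})^n\frac1{(i\lambda)^n}\,dZ(\lambda),$$ with the spectral characteristic $$h_{m,\mu}(\lambda)=e^{i\lambda m}-e^{i\lambda m}\,\Phi_\mu^{-1}(e^{-i\lambda})\sum_{k=0}^{m}\varphi_\mu(k)e^{-i\lambda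 k}.$$ It is also the unique optimal estimate in the closed linear span of the increments $\xi^{(n)}(k,\mu)$, $k\le-1$, of the single step $\mu$. Its mean square error is $$\mathsf E\bigl|\xi^{(n)}(m,\mu)-\hat\xi^{(n)}(m,\mu)\bigr|^2=\frac1{2\pi}\int_{-\pi}^{\pi}\Bigl|\sum_{k=0}^m\varphi_\mu(k)e^{-i\lambda k}\Bigr|^2d\lambda=\sum_{k=0}^m|\varphi_\mu(k)|^2 .$$ -/

import Mathlib

open MeasureTheory Filter Topology

noncomputable section

namespace StatIncr

variable {Ω : Type*} [MeasurableSpace Ω]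

/-! Increments of a stochastic sequence -/

/-- The `n`-th increment with step `μ` of the sequence `ξ`:
`ξ⁽ⁿ⁾(m, μ) = ∑_{l=0}^{n} (-1)^l C(n,l) ξ(m - l μ)`. -/
def increment (n : ℕ) (ξ : ℤ → Ω → ℂ) (m μ : ℤ) : Ω → ℂ :=
  fun ω => ∑ l ∈ Finset.range (n + 1), (-1 : ℂ) ^ l * (n.choose l : ℂ) * ξ (m - l * μ) ω

/-- `ξ` is a sequence with (wide sense) stationary `n`-th increments: the increments have finite
second moments, and their first and second moments do not depend on the origin `m₀` of time. -/
structure HasStationaryIncrements (P : Measure Ω) (n : ℕ) (ξ : ℤ → Ω → ℂ) : Prop where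
  memLp : ∀ m μ : ℤ, MemLp (increment n ξ m μ) 2 P
  mean : ∃ c : ℤ → ℂ, ∀ m₀ μ : ℤ, ∫ ω, increment n ξ m₀ μ ω ∂P = c μ
  structural : ∃ D : ℤ → ℤ → ℤ → ℂ, ∀ m₀ m μ₁ μ₂ : ℤ,
    ∫ ω, increment n ξ (m₀ + m) μ₁ ω * (starRingEnd ℂ) (increment n ξ m₀ μ₂ ω) ∂P = D m μ₁ μ₂

/-- The increments as elements of the Hilbert space `L₂(Ω, P)`. -/
def incrementLp {P : Measure Ω} {n : ℕ} {ξ : ℤ → Ω → ℂ} (hξ : HasStationaryIncrements P n ξ)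
    (m μ : ℤ) : Lp ℂ 2 P :=
  (hξ.memLp m μ).toLp (increment n ξ m μ)

/-! Subspaces generated by a family `X m μ` of elements of `L₂(Ω, P)`
(`m` is the time, `μ` the step) -/

/-- `H^t(X)`: the closed linear span of all `X m μ` with `m ≤ t` and `μ > 0`. -/
def pastSpace {P : Measure Ω} (X : ℤ → ℤ → Lp ℂ 2 P) (t : ℤ) : Submodule ℂ (Lp ℂ 2 P) :=
  (Submodule.span ℂ {y | ∃ m μ : ℤ, m ≤ t ∧ 0 < μ ∧ X m μ = y}).topologicalClosure

/-- The closed linear span of the `X m μ` with `m ≤ t`, for one fixed step `μ`. -/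
def stepPastSpace {P : Measure Ω} (X : ℤ → ℤ → Lp ℂ 2 P) (μ t : ℤ) : Submodule ℂ (Lp ℂ 2 P) :=
  (Submodule.span ℂ {y | ∃ m : ℤ, m ≤ t ∧ X m μ = y}).topologicalClosure

/-- The remote past `S(X) = ⋂_t H^t(X)`. -/
def remotePast {P : Measure Ω} (X : ℤ → ℤ → Lp ℂ 2 P) : Submodule ℂ (Lp ℂ 2 P) :=
  ⨅ t : ℤ, pastSpace X t

theorem remotePast_isClosed {P : Measure Ω} (X : ℤ → ℤ → Lp ℂ 2 P) :
    IsClosed (remotePast X : Set (Lp ℂ 2 P)) := by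
  have h : (remotePast X : Set (Lp ℂ 2 P)) = ⋂ t : ℤ, (pastSpace X t : Set (Lp ℂ 2 P)) := by
    simp [remotePast]
  rw [h]
  exact isClosed_iInter fun t => Submodule.isClosed_topologicalClosure _

instance remotePast_completeSpace {P : Measure Ω} (X : ℤ → ℤ → Lp ℂ 2 P) :
    CompleteSpace (remotePast X) :=
  (remotePast_isClosed X).completeSpace_coe

/-- The singular component: orthogonal projection of `X m μ` to the remote past. -/
def singularPart {P : Measure Ω} (X : ℤ → ℤ → Lp ℂ 2 P) (m μ : ℤ) : Lp ℂ 2 P :=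
  (remotePast X).starProjection (X m μ)

/-- The regular component. -/
def regularPart {P : Measure Ω} (X : ℤ → ℤ → Lp ℂ 2 P) (m μ : ℤ) : Lp ℂ 2 P :=
  X m μ - singularPart X m μ

/-! Innovations and the canonical moving average representation -/

/-- `ε` is an innovation sequence for the family `Y`: centred, uncorrelated, of unit variance,
and `H^t(Y) = H^t(ε)` for all `t`. -/
structure IsInnovation {P : Measure Ω} (Y : ℤ → ℤ → Lp ℂ 2 P) (ε : ℤ → Lp ℂ 2 P) : Prop where
  mean_zero : ∀ m : ℤ, ∫ ω, ε m ω ∂P = 0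
  orthonormal : Orthonormal ℂ ε
  past_eq : ∀ t : ℤ,
    pastSpace Y t = (Submodule.span ℂ {y | ∃ m : ℤ, m ≤ t ∧ ε m = y}).topologicalClosure

/-- The canonical moving average representation `Y m μ = ∑_{k ≥ 0} φ_μ(k) ε(m - k)`, `μ > 0`,
with respect to the innovation sequence `ε`; the series converges in `L₂(Ω, P)`. -/
structure IsCanonicalRepresentation {P : Measure Ω} (Y : ℤ → ℤ → Lp ℂ 2 P)
    (ε : ℤ → Lp ℂ 2 P) (φ : ℤ → ℕ → ℂ) : Prop where
  innovation : IsInnovation Y ε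
  summable : ∀ μ : ℤ, 0 < μ → Summable fun k : ℕ => ‖φ μ k‖ ^ 2
  hasSum : ∀ μ : ℤ, 0 < μ → ∀ m : ℤ, HasSum (fun k : ℕ => φ μ k • ε (m - k)) (Y m μ)

/-! The spectral domain -/

/-- The measure `dλ / 2π` on `[-π, π)`. -/
def normLebesgue : Measure ℝ :=
  ENNReal.ofReal (2 * Real.pi)⁻¹ • volume.restrict (Set.Ico (-Real.pi) Real.pi)

instance normLebesgue_isFiniteMeasure : IsFiniteMeasure normLebesgue := by
  unfold normLebesgue
  exact Measure.smul_finite _ ENNReal.ofReal_ne_top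

/-- `e^{iλk}` as a function of `λ`. -/
def character (k : ℤ) (x : ℝ) : ℂ := Complex.exp (Complex.I * x * k)

theorem character_memLp (k : ℤ) : MemLp (character k) 2 normLebesgue := by
  refine MemLp.of_bound (C := 1) ?_ (Filter.Eventually.of_forall fun x => ?_)
  · unfold character
    exact (by fun_prop : Continuous fun x : ℝ =>
      Complex.exp (Complex.I * x * k)).aestronglyMeasurable
  · unfold character
    rw [Complex.norm_exp]
    simp

/-- `(1 - e^{-iλμ})^n / (iλ)^n` as a function of `λ` (the value at the single point `λ = 0` is
irrelevant below, where only measures with a density occur). -/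
def incrementFactor (n : ℕ) (μ : ℤ) (x : ℝ) : ℂ :=
  (1 - character (-μ) x) ^ n / (Complex.I * x) ^ n

/-- The boundary function `Φ(e^{-iλ}) = ∑_{k ≥ 0} φ(k) e^{-iλk}` of a square summable sequence;
the series converges in `L₂(dλ / 2π)`. -/
def boundaryFunction (φ : ℕ → ℂ) : Lp ℂ 2 normLebesgue :=
  ∑' k : ℕ, φ k • (character_memLp (-(k : ℤ))).toLp (character (-(k : ℤ)))

/-- The absolutely continuous spectral measure `dF(λ) = f(λ) dλ / 2π` on `[-π, π)`. -/
def spectralMeasure (f : ℝ → ℝ) : Measure ℝ :=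
  normLebesgue.withDensity fun x => ENNReal.ofReal (f x)

/-- `f` is the spectral density of the stationary `n`-th increments `Y`: their structural function
is `∫ e^{iλm} (1 - e^{-iμ₁λ})^n (1 - e^{iμ₂λ})^n λ^{-2n} dF(λ)` with `dF = f dλ / 2π`. (In
Mathlib's inner product of `L₂` the first argument is the conjugated one.) -/
structure IsSpectralDensity {P : Measure Ω} (n : ℕ) (Y : ℤ → ℤ → Lp ℂ 2 P) (f : ℝ → ℝ) :
    Prop where
  measurable : Measurable f
  nonneg : ∀ x ∈ Set.Ico (-Real.pi) Real.pi, 0 ≤ f x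
  integrable : IntegrableOn f (Set.Ico (-Real.pi) Real.pi)
  structural : ∀ m₀ m μ₁ μ₂ : ℤ,
    inner ℂ (Y m₀ μ₂) (Y (m₀ + m) μ₁) =
      ∫ x : ℝ, character m x * (1 - character (-μ₁) x) ^ n * (1 - character μ₂ x) ^ n
        / (x : ℂ) ^ (2 * n) ∂(spectralMeasure f)

/-! Orthogonal stochastic measures and the integral with respect to them -/

/-- `Z` is an orthogonal stochastic measure with structure measure `F`:
`E Z(A) conj(Z(B)) = F(A ∩ B)`. -/
def IsOrthogonalStochasticMeasure {P : Measure Ω} (F : Measure ℝ) (Z : Set ℝ → Lp ℂ 2 P) : Prop :=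
  ∀ A B : Set ℝ, MeasurableSet A → MeasurableSet B →
    inner ℂ (Z B) (Z A) = ((F.real (A ∩ B) : ℝ) : ℂ)

/-- The integral `∑_c c Z({s = c})` of a simple function `s`. -/
def simpleIntegral {P : Measure Ω} (Z : Set ℝ → Lp ℂ 2 P) (s : SimpleFunc ℝ ℂ) : Lp ℂ 2 P :=
  ∑ c ∈ s.range, c • Z (s ⁻¹' {c})

/-- `η = ∫ u dZ`: `u ∈ L₂(F)` and `η` is the limit in `L₂(Ω, P)` of the integrals of simple
functions that converge to `u` in `L₂(F)`. -/
def HasStochasticIntegral {P : Measure Ω} (F : Measure ℝ) (Z : Set ℝ → Lp ℂ 2 P) (u : ℝ → ℂ)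
    (η : Lp ℂ 2 P) : Prop :=
  MemLp u 2 F ∧ ∃ s : ℕ → SimpleFunc ℝ ℂ,
    Tendsto (fun j => eLpNorm (fun x => u x - s j x) 2 F) atTop (𝓝 0) ∧
    Tendsto (fun j => simpleIntegral Z (s j)) atTop (𝓝 η)

/-- `Z` is the orthogonal stochastic measure of the spectral representation
`Y m μ = ∫ e^{iλm} (1 - e^{-iμλ})^n / (iλ)^n dZ(λ)`, with structure measure `f dλ / 2π`. -/
structure IsSpectralStochasticMeasure {P : Measure Ω} (n : ℕ) (Y : ℤ → ℤ → Lp ℂ 2 P) (f : ℝ → ℝ)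
    (Z : Set ℝ → Lp ℂ 2 P) : Prop where
  orthogonal : IsOrthogonalStochasticMeasure (spectralMeasure f) Z
  representation : ∀ m μ : ℤ, HasStochasticIntegral (spectralMeasure f) Z
    (fun x => character m x * incrementFactor n μ x) (Y m μ)

/-! Optimal linear estimates -/

/-- The mean square error `E |η - e|²`. -/
def meanSquareError {P : Measure Ω} (η e : Lp ℂ 2 P) : ℝ := ∫ ω, ‖η ω - e ω‖ ^ 2 ∂P

/-- `e` is an optimal mean square estimate of `η` among the elements of the subspace `K`. -/
def IsOptimalEstimate {P : Measure Ω} (K : Submodule ℂ (Lp ℂ 2 P)) (η e : Lp ℂ 2 P) : Prop :=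
  e ∈ K ∧ ∀ e' ∈ K, meanSquareError η e ≤ meanSquareError η e'

/-- The function
`h_m(λ) = e^{iλm} - e^{iλm} Φ(e^{-iλ})⁻¹ ∑_{k=0}^{m} φ(k) e^{-iλk}`. -/
def spectralCharacteristic (φ : ℕ → ℂ) (m : ℕ) (x : ℝ) : ℂ :=
  character m x - character m x * (boundaryFunction φ x)⁻¹ *
    ∑ k ∈ Finset.range (m + 1), φ k * character (-(k : ℤ)) x

end StatIncr

end

open MeasureTheory Filter Topology

noncomputable section

namespace StatIncr

variable {Ω : Type*} [MeasurableSpace Ω]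

/-! Families of vectors with equal Gram matrices -/

section Gram

variable {ι H H' : Type*} [NormedAddCommGroup H] [InnerProductSpace ℂ H]
  [NormedAddCommGroup H'] [InnerProductSpace ℂ H']

/-! Write X = S + R for the increments, S singular and R regular, and let δ be the sum of φ_μ(k)
ε_{m-k} over k ≤ m. The innovations in δ have times in [0, m], so δ is orthogonal to the past up to
-1. The rest, X(m, μ) - δ, consists of S(m, μ) and innovations of times at most -1, so it lies in
that past. Hence X(m, μ) - δ is the projection, and the error is ‖δ‖² = ∑ |φ_μ(k)|². Two points need
work.

Spectral form of δ. Let g_μ denote `incrementFactor n μ`. There are two isometries into L₂(P): J,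
the integral against Z, sends e^{iλm} g_μ to R(m, μ); K sends e^{iλj} to ε_j, hence e^{iλm} Φ_μ to
R(m, μ). Comparing Gram matrices and using uniqueness of Fourier coefficients gives |Φ_μ|² = f
|g_μ|² almost everywhere (`conj_boundaryFunction_mul_ae_eq`). Since the innovations lie in the span
of R, f cannot vanish on a set of positive measure (`density_ae_ne_zero`), so Φ_μ ≠ 0 almost
everywhere. It follows that ε_j = J(e^{iλj} Φ_μ⁻¹ g_μ) (`map_innovationKernel`), and the formula for
h_{m,μ} is linearity.

A single step suffices. A bounded backward shift B satisfies X(m, N) = q(B) X(m, 1) with q(z) = ((1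
- z^N)/(1 - z))^n, so q(B) maps the whole past into the past of step N. This puts S(m, N) and (1 -
B^N)^n ε_j, j ≤ -1, there. The factors 1 - B^N are then removed one by one: a failure would give an
orthonormal sequence with constant nonzero coefficients, against Bessel's inequality
(`mem_of_sub_mem_of_orthonormal`). -/

theorem norm_linearCombination_eq_of_inner_eq {v : ι → H} {w : ι → H'}
    (h : ∀ i j, inner ℂ (v i) (v j) = inner ℂ (w i) (w j)) (a : ι →₀ ℂ) :
    ‖Finsupp.linearCombination ℂ w a‖ = ‖Finsupp.linearCombination ℂ v a‖ := by
  have key : inner ℂ (Finsupp.linearCombination ℂ w a) (Finsupp.linearCombination ℂ w a) =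
      inner ℂ (Finsupp.linearCombination ℂ v a) (Finsupp.linearCombination ℂ v a) := by
    simp only [Finsupp.linearCombination_apply, Finsupp.sum, sum_inner, inner_sum,
      inner_smul_left, inner_smul_right, h]
  rw [inner_self_eq_norm_sq_to_K, inner_self_eq_norm_sq_to_K] at key
  have key' : ‖Finsupp.linearCombination ℂ w a‖ ^ 2 = ‖Finsupp.linearCombination ℂ v a‖ ^ 2 := by
    exact_mod_cast key
  exact (pow_left_inj₀ (norm_nonneg _) (norm_nonneg _) two_ne_zero).1 key'

theorem topologicalClosure_span_range_eq_top [CompleteSpace H] {v : ι → H}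
    (hv : ∀ x : H, (∀ i, inner ℂ (v i) x = 0) → x = 0) :
    (Submodule.span ℂ (Set.range v)).topologicalClosure = ⊤ := by
  rw [Submodule.topologicalClosure_eq_top_iff, Submodule.eq_bot_iff]
  intro x hx
  refine hv x fun i => ?_
  exact (Submodule.mem_orthogonal _ _).1 hx _ (Submodule.subset_span ⟨i, rfl⟩)

/-- Equal Gram matrices make finite combinations of both families equal in norm, so matching
coefficients is well defined and isometric on a dense subspace; it extends by continuity. -/
theorem exists_linearIsometry_of_inner_eq [CompleteSpace H] [CompleteSpace H']
    {v : ι → H} {w : ι → H'}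
    (hv : (Submodule.span ℂ (Set.range v)).topologicalClosure = ⊤)
    (h : ∀ i j, inner ℂ (v i) (v j) = inner ℂ (w i) (w j)) :
    ∃ J : H →ₗᵢ[ℂ] H', ∀ i, J (v i) = w i := by
  have hd : DenseRange (Finsupp.linearCombination ℂ v) := by
    have := (Submodule.dense_iff_topologicalClosure_eq_top).2 hv
    rwa [← Finsupp.range_linearCombination, LinearMap.coe_range] at this
  have hn := norm_linearCombination_eq_of_inner_eq h
  have hn' : ∃ C : ℝ, ∀ a, ‖Finsupp.linearCombination ℂ w a‖ ≤
      C * ‖Finsupp.linearCombination ℂ v a‖ := ⟨1, fun a => by rw [one_mul, hn]⟩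
  have he := LinearMap.extendOfNorm_eq hd hn'
  set J := (Finsupp.linearCombination ℂ w).extendOfNorm (Finsupp.linearCombination ℂ v) with hJ
  have hJn : ∀ x, ‖J x‖ = ‖x‖ := fun x => by
    refine hd.induction_on (p := fun x => ‖J x‖ = ‖x‖) x
      (isClosed_eq (by fun_prop) (by fun_prop)) fun a => ?_
    rw [he, hn]
  refine ⟨⟨J.toLinearMap, hJn⟩, fun i => ?_⟩
  simpa using he (Finsupp.single i 1)

/-- Without totality, the isometry is built on the closed span and extended by zero to its
orthogonal complement; only boundedness survives. -/
theorem exists_continuousLinearMap_of_inner_eq [CompleteSpace H] [CompleteSpace H']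
    {v : ι → H} {w : ι → H'} (h : ∀ i j, inner ℂ (v i) (v j) = inner ℂ (w i) (w j)) :
    ∃ J : H →L[ℂ] H', ∀ i, J (v i) = w i := by
  set K := (Submodule.span ℂ (Set.range v)).topologicalClosure with hK
  have hmem : ∀ i, v i ∈ K := fun i =>
    Submodule.le_topologicalClosure _ (Submodule.subset_span ⟨i, rfl⟩)
  let v' : ι → K := fun i => ⟨v i, hmem i⟩
  have hcK : IsClosed (K : Set H) := Submodule.isClosed_topologicalClosure _
  have : CompleteSpace K := hcK.completeSpace_coe
  have hv' : (Submodule.span ℂ (Set.range v')).topologicalClosure = ⊤ := by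
    refine topologicalClosure_span_range_eq_top fun x hx => ?_
    have hle : K ≤ (Submodule.span ℂ {(x : H)})ᗮ := by
      refine Submodule.topologicalClosure_minimal _ ?_ (Submodule.isClosed_orthogonal _)
      rw [Submodule.span_le]
      rintro _ ⟨i, rfl⟩
      refine Submodule.mem_orthogonal_singleton_iff_inner_left.2 ?_
      exact hx i
    have := Submodule.mem_orthogonal_singleton_iff_inner_left.1 (hle x.2)
    exact Subtype.ext (inner_self_eq_zero.1 this)
  obtain ⟨J, hJ⟩ := exists_linearIsometry_of_inner_eq hv' (w := w) (fun i j => h i j)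
  refine ⟨J.toContinuousLinearMap.comp K.orthogonalProjectionOnto, fun i => ?_⟩
  have : K.orthogonalProjectionOnto (v i) = v' i :=
    Submodule.orthogonalProjectionOnto_mem_subspace_eq_self (v' i)
  simp [this, hJ]

theorem map_mem_of_topologicalClosure (T : H →L[ℂ] H') {s : Set H} {W : Submodule ℂ H'}
    (hW : IsClosed (W : Set H')) (h : ∀ x ∈ s, T x ∈ W) {x : H}
    (hx : x ∈ (Submodule.span ℂ s).topologicalClosure) : T x ∈ W := by
  have hle : (Submodule.span ℂ s).topologicalClosure ≤ W.comap T.toLinearMap :=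
    Submodule.topologicalClosure_minimal _ (Submodule.span_le.2 h) (hW.preimage T.continuous)
  exact hle hx

theorem inner_eq_zero_of_mem_topologicalClosure_span {s : Set H} {y : H}
    (h : ∀ x ∈ s, inner ℂ x y = 0) {x : H}
    (hx : x ∈ (Submodule.span ℂ s).topologicalClosure) : inner ℂ x y = 0 := by
  have hle : (Submodule.span ℂ s).topologicalClosure ≤ (Submodule.span ℂ {y})ᗮ :=
    Submodule.topologicalClosure_minimal _ (Submodule.span_le.2 fun z hz =>
      Submodule.mem_orthogonal_singleton_iff_inner_left.2 (h z hz))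
      (Submodule.isClosed_orthogonal _)
  exact Submodule.mem_orthogonal_singleton_iff_inner_left.1 (hle hx)

theorem eq_zero_of_inner_eq_zero {v : ι → H}
    (hv : (Submodule.span ℂ (Set.range v)).topologicalClosure = ⊤) {x : H}
    (h : ∀ i, inner ℂ (v i) x = 0) : x = 0 := by
  refine inner_self_eq_zero.1 (inner_eq_zero_of_mem_topologicalClosure_span
    (s := Set.range v) ?_ (hv ▸ Submodule.mem_top))
  rintro _ ⟨i, rfl⟩
  exact h i

end Gram

/-! Characters -/

theorem continuous_character (k : ℤ) : Continuous (character k) := by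
  unfold character
  fun_prop

theorem norm_character (k : ℤ) (x : ℝ) : ‖character k x‖ = 1 := by
  unfold character
  rw [Complex.norm_exp]
  simp

theorem character_add (j k : ℤ) (x : ℝ) : character (j + k) x = character j x * character k x := by
  unfold character
  rw [← Complex.exp_add]
  push_cast
  ring_nf

theorem character_zero (x : ℝ) : character 0 x = 1 := by simp [character]

theorem conj_character (k : ℤ) (x : ℝ) :
    (starRingEnd ℂ) (character k x) = character (-k) x := by
  unfold character
  rw [← Complex.exp_conj]
  simp

theorem norm_one_sub_character_le (k : ℤ) (x : ℝ) :
    ‖1 - character k x‖ ≤ |(k : ℝ)| * |x| := by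
  have h := Real.norm_exp_I_mul_ofReal_sub_one_le (x := x * k)
  rw [norm_sub_rev]
  unfold character
  rw [mul_comm |(k : ℝ)|, ← abs_mul, ← Real.norm_eq_abs]
  have he : Complex.I * x * k = Complex.I * ((x * k : ℝ) : ℂ) := by
    push_cast
    ring
  rwa [he]

theorem norm_incrementFactor_le (n : ℕ) (μ : ℤ) (x : ℝ) :
    ‖incrementFactor n μ x‖ ≤ |(μ : ℝ)| ^ n := by
  unfold incrementFactor
  rw [← div_pow, norm_pow]
  refine pow_le_pow_left₀ (norm_nonneg _) ?_ n
  rw [norm_div]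
  refine div_le_of_le_mul₀ (norm_nonneg _) (abs_nonneg _) ?_
  have := norm_one_sub_character_le (-μ) x
  simpa using this

theorem measurable_character (k : ℤ) : Measurable (character k) :=
  (continuous_character k).measurable

theorem measurable_incrementFactor (n : ℕ) (μ : ℤ) : Measurable (incrementFactor n μ) := by
  unfold incrementFactor
  have := measurable_character (-μ)
  fun_prop

theorem countable_setOf_incrementFactor_eq_zero (n : ℕ) {μ : ℤ} (hμ : μ ≠ 0) :
    {x : ℝ | incrementFactor n μ x = 0}.Countable := by
  -- The point 0 is listed separately: for n > 0 the quotient there is 0 / 0 = 0.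
  have hs : {x : ℝ | incrementFactor n μ x = 0} ⊆
      {0} ∪ Set.range fun k : ℤ => -(2 * Real.pi * k / μ) := by
    intro x hx
    by_cases hx0 : x = 0
    · exact Or.inl hx0
    right
    have hden : (Complex.I * (x : ℂ)) ^ n ≠ 0 :=
      pow_ne_zero _ (mul_ne_zero Complex.I_ne_zero (by exact_mod_cast hx0))
    have h1 : (1 - character (-μ) x) ^ n = 0 := by
      have : incrementFactor n μ x = 0 := hx
      unfold incrementFactor at this
      exact (div_eq_zero_iff.1 this).resolve_right hden
    have h2 : character (-μ) x = 1 := (sub_eq_zero.1 (eq_zero_of_pow_eq_zero h1)).symm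
    unfold character at h2
    obtain ⟨k, hk⟩ := Complex.exp_eq_one_iff.1 h2
    refine ⟨k, ?_⟩
    have h3 : ((x * (-μ) : ℝ) : ℂ) = ((k * (2 * Real.pi) : ℝ) : ℂ) := by
      apply mul_left_cancel₀ Complex.I_ne_zero
      push_cast at hk ⊢
      linear_combination hk
    have h4 : x * (-μ) = k * (2 * Real.pi) := by exact_mod_cast h3
    have hμ' : (μ : ℝ) ≠ 0 := by exact_mod_cast hμ
    change -(2 * Real.pi * k / μ) = x
    rw [neg_eq_iff_eq_neg, div_eq_iff hμ']
    linear_combination -h4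
  exact ((Set.countable_singleton 0).union (Set.countable_range _)).mono hs

/-! Uniqueness of Fourier coefficients -/

/-- Integration against w is a functional bounded in the sup norm; it vanishes on the Fourier
monomials, whose span is dense in the continuous functions on the circle. -/
theorem integral_comp_coe_eq_zero {F : Measure ℝ} {w : ℝ → ℂ}
    (hw : Integrable w F) (h : ∀ m : ℤ, ∫ x, character m x * w x ∂F = 0)
    (c : C(AddCircle (2 * Real.pi), ℂ)) : ∫ x : ℝ, c (x : AddCircle (2 * Real.pi)) * w x ∂F = 0 := by
  have : Fact (0 < 2 * Real.pi) := ⟨Real.two_pi_pos⟩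
  have hint : ∀ c : C(AddCircle (2 * Real.pi), ℂ),
      Integrable (fun x : ℝ => c (x : AddCircle (2 * Real.pi)) * w x) F := fun c =>
    hw.bdd_mul (c := ‖c‖)
      (c.continuous.comp (AddCircle.continuous_mk' _)).aestronglyMeasurable
      (Eventually.of_forall fun x => c.norm_coe_le_norm _)
  let L : C(AddCircle (2 * Real.pi), ℂ) →ₗ[ℂ] ℂ :=
    { toFun := fun c => ∫ x : ℝ, c (x : AddCircle (2 * Real.pi)) * w x ∂F
      map_add' := fun a b => by
        rw [← integral_add (hint a) (hint b)]
        simp [add_mul]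
      map_smul' := fun a b => by
        rw [RingHom.id_apply, smul_eq_mul, ← integral_const_mul]
        simp [mul_assoc] }
  let L' : C(AddCircle (2 * Real.pi), ℂ) →L[ℂ] ℂ :=
    L.mkContinuous (∫ x, ‖w x‖ ∂F) fun c => by
      refine (norm_integral_le_of_norm_le (hw.norm.const_mul ‖c‖)
        (Eventually.of_forall fun x => ?_)).trans ?_
      · rw [norm_mul]
        exact mul_le_mul_of_nonneg_right (c.norm_coe_le_norm _) (norm_nonneg _)
      · rw [integral_const_mul, mul_comm]
  have hker : (Submodule.span ℂ (Set.range (@fourier (2 * Real.pi)))).topologicalClosure ≤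
      LinearMap.ker L'.toLinearMap := by
    refine Submodule.topologicalClosure_minimal _ ?_ L'.isClosed_ker
    rw [Submodule.span_le]
    rintro _ ⟨m, rfl⟩
    change ∫ x : ℝ, fourier m (x : AddCircle (2 * Real.pi)) * w x ∂F = 0
    rw [← h m]
    congr 1
    ext x
    congr 1
    rw [fourier_coe_apply]
    unfold character
    congr 1
    have : (Real.pi : ℂ) ≠ 0 := by exact_mod_cast Real.pi_ne_zero
    push_cast
    field_simp
  rw [span_fourier_closure_eq_top] at hker
  exact hker (Submodule.mem_top : c ∈ ⊤)

/-- A test function supported in the open interval vanishes at both endpoints, so it descends to a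
continuous function on the circle, where the previous lemma applies. -/
theorem ae_eq_zero_of_integral_character_mul_eq_zero {F : Measure ℝ}
    (hF : ∀ᵐ x ∂F, x ∈ Set.Ioo (-Real.pi) Real.pi) {w : ℝ → ℂ} (hw : Integrable w F)
    (h : ∀ m : ℤ, ∫ x, character m x * w x ∂F = 0) : ∀ᵐ x ∂F, w x = 0 := by
  have : Fact (0 < 2 * Real.pi) := ⟨Real.two_pi_pos⟩
  have key := isOpen_Ioo.ae_eq_zero_of_integral_contDiff_smul_eq_zero
    (U := Set.Ioo (-Real.pi) Real.pi) (f := w) (μ := F)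
    (hw.locallyIntegrable.locallyIntegrableOn _) ?_
  · filter_upwards [hF, key] with x hx hx' using hx' hx
  intro g hg _ hgs
  have hz : ∀ x, x ∉ Set.Ioo (-Real.pi) Real.pi → g x = 0 := fun x hx =>
    image_eq_zero_of_notMem_tsupport fun hx' => hx (hgs hx')
  have hend : -Real.pi + 2 * Real.pi = Real.pi := by ring
  let c : C(AddCircle (2 * Real.pi), ℂ) :=
    ⟨AddCircle.liftIco (2 * Real.pi) (-Real.pi) fun x => (g x : ℂ),
      AddCircle.liftIco_continuous (by rw [hend, hz _ (by simp), hz _ (by simp)])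
        (Complex.continuous_ofReal.comp hg.continuous).continuousOn⟩
  rw [← integral_comp_coe_eq_zero hw h c]
  refine integral_congr_ae ?_
  filter_upwards [hF] with x hx
  have : c (x : AddCircle (2 * Real.pi)) = (g x : ℂ) :=
    AddCircle.liftIco_coe_apply (f := fun x => (g x : ℂ)) ⟨hx.1.le, by rw [hend]; exact hx.2⟩
  rw [this, Complex.real_smul]

/-! ### Normalised Lebesgue measure and the orthonormal system of characters -/

theorem normLebesgue_ae_mem_Ioo : ∀ᵐ x ∂normLebesgue, x ∈ Set.Ioo (-Real.pi) Real.pi := by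
  unfold normLebesgue
  refine Measure.ae_smul_measure ?_ _
  filter_upwards [ae_restrict_mem measurableSet_Ico,
    ae_restrict_of_ae (compl_mem_ae_iff.2 (measure_singleton (-Real.pi)))] with x hx hx'
  exact ⟨lt_of_le_of_ne hx.1 fun h => hx' h.symm, hx.2⟩

theorem ae_normLebesgue_of_countable {p : ℝ → Prop} (h : {x | ¬ p x}.Countable) :
    ∀ᵐ x ∂normLebesgue, p x := by
  unfold normLebesgue
  exact Measure.ae_smul_measure (ae_restrict_of_ae (h.measure_zero _)) _

theorem integral_normLebesgue (g : ℝ → ℂ) :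
    ∫ x, g x ∂normLebesgue = ((2 * Real.pi)⁻¹ : ℝ) • ∫ x in (-Real.pi)..Real.pi, g x := by
  unfold normLebesgue
  rw [integral_smul_measure, ENNReal.toReal_ofReal (by positivity),
    intervalIntegral.integral_of_le (by linarith [Real.pi_pos]), integral_Ico_eq_integral_Ioc]

/-- The character `e^{iλk}` as an element of `L₂(dλ / 2π)`. -/
def characterLp (k : ℤ) : Lp ℂ 2 normLebesgue := (character_memLp k).toLp (character k)

theorem inner_characterLp_left (k : ℤ) {u : ℝ → ℂ} (hu : MemLp u 2 normLebesgue) :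
    inner ℂ (characterLp k) (hu.toLp u) = ∫ x, character (-k) x * u x ∂normLebesgue := by
  rw [L2.inner_def]
  refine integral_congr_ae ?_
  filter_upwards [hu.coeFn_toLp, (character_memLp k).coeFn_toLp] with x h1 h2
  simp only [characterLp, h1, h2, RCLike.inner_apply, conj_character]
  ring

theorem integral_character (k : ℤ) :
    ∫ x, character k x ∂normLebesgue = if k = 0 then 1 else 0 := by
  rw [integral_normLebesgue]
  split_ifs with h
  · subst h
    simp only [character_zero]
    rw [intervalIntegral.integral_const]
    have : Real.pi ≠ 0 := Real.pi_ne_zero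
    simp only [smul_smul, sub_neg_eq_add]
    rw [show (2 * Real.pi)⁻¹ * (Real.pi + Real.pi) = 1 by field_simp; ring, one_smul]
  · have hc : Complex.I * (k : ℂ) ≠ 0 := mul_ne_zero Complex.I_ne_zero (by exact_mod_cast h)
    have : ∀ x : ℝ, character k x = Complex.exp (Complex.I * k * x) := fun x => by
      unfold character
      ring_nf
    simp only [this]
    rw [integral_exp_mul_complex hc]
    have : Complex.exp (Complex.I * k * (Real.pi : ℝ)) =
        Complex.exp (Complex.I * k * (-Real.pi : ℝ)) := by
      rw [Complex.exp_eq_exp_iff_exists_int]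
      exact ⟨k, by push_cast; ring⟩
    rw [this, sub_self, zero_div, smul_zero]

theorem orthonormal_characterLp : Orthonormal ℂ characterLp := by
  rw [orthonormal_iff_ite]
  intro j k
  rw [characterLp.eq_1 k, inner_characterLp_left]
  simp only [← character_add, integral_character, neg_add_eq_zero]

theorem characterLp_total : (Submodule.span ℂ (Set.range characterLp)).topologicalClosure = ⊤ := by
  refine topologicalClosure_span_range_eq_top fun u hu => ?_
  have h := Lp.memLp u
  refine Lp.eq_zero_iff_ae_eq_zero.2 ?_
  refine ae_eq_zero_of_integral_character_mul_eq_zero normLebesgue_ae_mem_Ioo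
    (h.integrable one_le_two) fun m => ?_
  have := hu (-m)
  rw [← Lp.toLp_coeFn u h, inner_characterLp_left, neg_neg] at this
  exact this

/-! The stochastic integral as an isometry -/

section StochasticIntegral

variable {P : Measure Ω} {F : Measure ℝ} [IsFiniteMeasure F]

/-- The indicator function of a measurable set as an element of `L₂(F)`. -/
def indicatorLp (F : Measure ℝ) [IsFiniteMeasure F] {A : Set ℝ} (hA : MeasurableSet A) :
    Lp ℂ 2 F :=
  indicatorConstLp 2 hA (measure_ne_top F A) (1 : ℂ)

theorem inner_indicatorLp_indicatorLp {A B : Set ℝ} (hA : MeasurableSet A) (hB : MeasurableSet B) :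
    inner ℂ (indicatorLp F hB) (indicatorLp F hA) = ((F.real (A ∩ B) : ℝ) : ℂ) := by
  unfold indicatorLp
  rw [L2.inner_indicatorConstLp_one, setIntegral_indicatorConstLp hB, Complex.real_smul, mul_one]

theorem indicatorLp_total :
    (Submodule.span ℂ (Set.range fun A : {A : Set ℝ // MeasurableSet A} =>
      indicatorLp F A.2)).topologicalClosure = ⊤ := by
  refine topologicalClosure_span_range_eq_top fun u hu => ?_
  refine Lp.eq_zero_iff_ae_eq_zero.2 ?_
  refine Lp.ae_eq_zero_of_forall_setIntegral_eq_zero u two_ne_zero ENNReal.ofNat_ne_top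
    (fun s _ _ => ((Lp.memLp u).integrable one_le_two).integrableOn) fun s hs _ => ?_
  have := hu ⟨s, hs⟩
  unfold indicatorLp at this
  rwa [L2.inner_indicatorConstLp_one] at this

theorem exists_isometry_of_isOrthogonalStochasticMeasure {Z : Set ℝ → Lp ℂ 2 P}
    (hZ : IsOrthogonalStochasticMeasure F Z) :
    ∃ J : Lp ℂ 2 F →ₗᵢ[ℂ] Lp ℂ 2 P, ∀ (A : Set ℝ) (hA : MeasurableSet A),
      J (indicatorLp F hA) = Z A := by
  obtain ⟨J, hJ⟩ := exists_linearIsometry_of_inner_eq (indicatorLp_total (F := F))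
    (w := fun A : {A : Set ℝ // MeasurableSet A} => Z A) fun A B => by
      rw [inner_indicatorLp_indicatorLp, hZ _ _ B.2 A.2]
  exact ⟨J, fun A hA => hJ ⟨A, hA⟩⟩

theorem simpleIntegral_eq {Z : Set ℝ → Lp ℂ 2 P} {J : Lp ℂ 2 F →ₗᵢ[ℂ] Lp ℂ 2 P}
    (hJ : ∀ (A : Set ℝ) (hA : MeasurableSet A), J (indicatorLp F hA) = Z A)
    (s : SimpleFunc ℝ ℂ) (hs : MemLp s 2 F) : simpleIntegral Z s = J (hs.toLp s) := by
  have h : hs.toLp s = ∑ c ∈ s.range, c • indicatorLp F (s.measurableSet_preimage {c}) := by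
    refine Lp.ext ?_
    refine hs.coeFn_toLp.trans (.symm ?_)
    refine (Lp.coeFn_finsetSum _ _).trans ?_
    have h1 : ∀ᵐ x ∂F, ∀ c ∈ s.range,
        (c • indicatorLp F (s.measurableSet_preimage {c}) : Lp ℂ 2 F) x =
          c * (s ⁻¹' {c}).indicator (fun _ => (1 : ℂ)) x := by
      refine (Finset.eventually_all _).2 fun c _ => ?_
      filter_upwards [Lp.coeFn_smul c (indicatorLp F (s.measurableSet_preimage {c})),
        indicatorConstLp_coeFn (p := 2) (hs := s.measurableSet_preimage {c})
          (hμs := measure_ne_top F _) (c := (1 : ℂ))] with x h2 h3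
      rw [h2, Pi.smul_apply, indicatorLp, h3, smul_eq_mul]
    filter_upwards [h1] with x hx
    rw [Finset.sum_apply, Finset.sum_congr rfl hx, Finset.sum_eq_single (s x)]
    · simp
    · intro c _ hc
      simp [Ne.symm hc]
    · intro h
      exact absurd (s.mem_range_self x) h
  rw [h, map_sum]
  simp only [map_smul, hJ]
  rfl

/-- By continuity of J the limit is the same for every approximating sequence, so statements about ∫
u dZ become statements about J. -/
theorem hasStochasticIntegral_iff {Z : Set ℝ → Lp ℂ 2 P} {J : Lp ℂ 2 F →ₗᵢ[ℂ] Lp ℂ 2 P}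
    (hJ : ∀ (A : Set ℝ) (hA : MeasurableSet A), J (indicatorLp F hA) = Z A)
    {u : ℝ → ℂ} (hu : MemLp u 2 F) {η : Lp ℂ 2 P} :
    HasStochasticIntegral F Z u η ↔ J (hu.toLp u) = η := by
  have hs : ∀ s : SimpleFunc ℝ ℂ, MemLp s 2 F := fun s => s.memLp_of_isFiniteMeasure 2 F
  have key : ∀ s : ℕ → SimpleFunc ℝ ℂ,
      Tendsto (fun j => eLpNorm (fun x => u x - s j x) 2 F) atTop (𝓝 0) →
      Tendsto (fun j => simpleIntegral Z (s j)) atTop (𝓝 (J (hu.toLp u))) := by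
    intro s h
    simp only [fun j => simpleIntegral_eq hJ (s j) (hs _)]
    refine (J.continuous.tendsto _).comp ?_
    rw [Lp.tendsto_Lp_iff_tendsto_eLpNorm'' _ (fun j => hs (s j)) _ hu]
    refine h.congr fun j => ?_
    rw [← eLpNorm_neg]
    congr 1
    ext x
    simp
  constructor
  · rintro ⟨_, s, h1, h2⟩
    exact tendsto_nhds_unique (key s h1) h2
  · rintro rfl
    have hex : ∀ j : ℕ, ∃ s : SimpleFunc ℝ ℂ,
        eLpNorm (fun x => u x - s x) 2 F < ((j : ENNReal) + 1)⁻¹ ∧ MemLp s 2 F := fun j => by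
      exact hu.exists_simpleFunc_eLpNorm_sub_lt ENNReal.ofNat_ne_top (by simp)
    choose s h1 _ using hex
    have hlim : Tendsto (fun j => eLpNorm (fun x => u x - s j x) 2 F) atTop (𝓝 0) := by
      refine tendsto_of_tendsto_of_tendsto_of_le_of_le tendsto_const_nhds
        (h := fun j : ℕ => ((j : ENNReal) + 1)⁻¹) ?_ (fun _ => zero_le) fun j => (h1 j).le
      have := (tendsto_add_atTop_iff_nat 1).2 ENNReal.tendsto_inv_nat_nhds_zero
      simpa using this
    exact ⟨hu, s, hlim, key s hlim⟩

theorem isOrthogonalStochasticMeasure_of_isometry (J : Lp ℂ 2 F →ₗᵢ[ℂ] Lp ℂ 2 P) :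
    ∃ Z : Set ℝ → Lp ℂ 2 P, IsOrthogonalStochasticMeasure F Z ∧
      ∀ (A : Set ℝ) (hA : MeasurableSet A), J (indicatorLp F hA) = Z A := by
  classical
  refine ⟨fun A => if hA : MeasurableSet A then J (indicatorLp F hA) else 0, ?_, ?_⟩
  · intro A B hA hB
    simp only [dif_pos hA, dif_pos hB, J.inner_map_map, inner_indicatorLp_indicatorLp]
  · intro A hA
    simp only [dif_pos hA]

end StochasticIntegral

/-! The spectral measure -/

section SpectralMeasure

variable {f : ℝ → ℝ}

theorem normLebesgue_ae_nonneg (hf0 : ∀ x ∈ Set.Ico (-Real.pi) Real.pi, 0 ≤ f x) :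
    ∀ᵐ x ∂normLebesgue, 0 ≤ f x := by
  filter_upwards [normLebesgue_ae_mem_Ioo] with x hx using hf0 x ⟨hx.1.le, hx.2⟩

theorem isFiniteMeasure_spectralMeasure (hfi : IntegrableOn f (Set.Ico (-Real.pi) Real.pi)) :
    IsFiniteMeasure (spectralMeasure f) := by
  have : Integrable f normLebesgue := by
    unfold normLebesgue
    exact hfi.smul_measure ENNReal.ofReal_ne_top
  exact isFiniteMeasure_withDensity_ofReal this.2

theorem spectralMeasure_absolutelyContinuous (f : ℝ → ℝ) :
    spectralMeasure f ≪ normLebesgue := withDensity_absolutelyContinuous _ _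

theorem spectralMeasure_ae_mem_Ioo (f : ℝ → ℝ) :
    ∀ᵐ x ∂spectralMeasure f, x ∈ Set.Ioo (-Real.pi) Real.pi :=
  (spectralMeasure_absolutelyContinuous f).ae_le normLebesgue_ae_mem_Ioo

theorem integral_spectralMeasure (hfm : Measurable f)
    (hf0 : ∀ x ∈ Set.Ico (-Real.pi) Real.pi, 0 ≤ f x) (g : ℝ → ℂ) :
    ∫ x, g x ∂spectralMeasure f = ∫ x, (f x : ℂ) * g x ∂normLebesgue := by
  unfold spectralMeasure
  rw [integral_withDensity_eq_integral_toReal_smul hfm.ennreal_ofReal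
    (Eventually.of_forall fun x => ENNReal.ofReal_lt_top)]
  refine integral_congr_ae ?_
  filter_upwards [normLebesgue_ae_nonneg hf0] with x hx
  rw [ENNReal.toReal_ofReal hx, Complex.real_smul]

theorem integrable_spectralMeasure_iff (hfm : Measurable f)
    (hf0 : ∀ x ∈ Set.Ico (-Real.pi) Real.pi, 0 ≤ f x) {g : ℝ → ℂ} :
    Integrable g (spectralMeasure f) ↔ Integrable (fun x => (f x : ℂ) * g x) normLebesgue := by
  unfold spectralMeasure
  rw [integrable_withDensity_iff_integrable_smul' hfm.ennreal_ofReal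
    (Eventually.of_forall fun x => ENNReal.ofReal_lt_top)]
  refine integrable_congr ?_
  filter_upwards [normLebesgue_ae_nonneg hf0] with x hx
  rw [ENNReal.toReal_ofReal hx, Complex.real_smul]

end SpectralMeasure

/-! The spectral representation -/

section SpectralRepresentation

variable {P : Measure Ω} {n : ℕ} {Y : ℤ → ℤ → Lp ℂ 2 P} {f : ℝ → ℝ}

theorem memLp_character_mul_incrementFactor (F : Measure ℝ) [IsFiniteMeasure F] (n : ℕ)
    (m μ : ℤ) : MemLp (fun x => character m x * incrementFactor n μ x) 2 F := by
  refine MemLp.of_bound (C := |(μ : ℝ)| ^ n)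
    ((measurable_character m).mul (measurable_incrementFactor n μ)).aestronglyMeasurable
    (Eventually.of_forall fun x => ?_)
  rw [norm_mul, norm_character, one_mul]
  exact norm_incrementFactor_le n μ x

/-- The function `e^{iλm} (1 - e^{-iλμ})^n / (iλ)^n` as an element of `L₂(F)`. -/
def incrementKernelLp (F : Measure ℝ) [IsFiniteMeasure F] (n : ℕ) (m μ : ℤ) : Lp ℂ 2 F :=
  (memLp_character_mul_incrementFactor F n m μ).toLp _

theorem inner_toLp_toLp {F : Measure ℝ} {u v : ℝ → ℂ} (hu : MemLp u 2 F) (hv : MemLp v 2 F) :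
    inner ℂ (hu.toLp u) (hv.toLp v) = ∫ x, (starRingEnd ℂ) (u x) * v x ∂F := by
  rw [L2.inner_def]
  refine integral_congr_ae ?_
  filter_upwards [hu.coeFn_toLp, hv.coeFn_toLp] with x h1 h2
  rw [h1, h2, RCLike.inner_apply, mul_comm]

theorem conj_incrementFactor_mul_incrementFactor (n : ℕ) (μ₁ μ₂ : ℤ) (x : ℝ) :
    (starRingEnd ℂ) (incrementFactor n μ₂ x) * incrementFactor n μ₁ x =
      (1 - character (-μ₁) x) ^ n * (1 - character μ₂ x) ^ n / (x : ℂ) ^ (2 * n) := by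
  have hden : (-Complex.I * (x : ℂ)) ^ n * (Complex.I * x) ^ n = (x : ℂ) ^ (2 * n) := by
    rw [← mul_pow, pow_mul]
    congr 1
    linear_combination -(x : ℂ) ^ 2 * Complex.I_sq
  unfold incrementFactor
  rw [map_div₀, map_pow, map_pow, map_sub, map_one, conj_character, neg_neg, map_mul,
    Complex.conj_I, Complex.conj_ofReal, div_mul_div_comm, hden, mul_comm (_ ^ n)]

theorem IsSpectralDensity.isFiniteMeasure (hf : IsSpectralDensity n Y f) :
    IsFiniteMeasure (spectralMeasure f) :=
  isFiniteMeasure_spectralMeasure hf.integrable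

theorem IsSpectralDensity.inner_incrementKernelLp (hf : IsSpectralDensity n Y f)
    [IsFiniteMeasure (spectralMeasure f)] (m₁ m₂ μ₁ μ₂ : ℤ) :
    inner ℂ (incrementKernelLp (spectralMeasure f) n m₂ μ₂)
      (incrementKernelLp (spectralMeasure f) n m₁ μ₁) = inner ℂ (Y m₂ μ₂) (Y m₁ μ₁) := by
  have h := hf.structural m₂ (m₁ - m₂) μ₁ μ₂
  rw [add_sub_cancel] at h
  rw [h, incrementKernelLp, incrementKernelLp, inner_toLp_toLp]
  refine integral_congr_ae (Eventually.of_forall fun x => ?_)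
  have h1 := conj_incrementFactor_mul_incrementFactor n μ₁ μ₂ x
  have h2 := character_add m₁ (-m₂) x
  simp only [map_mul, conj_character, sub_eq_add_neg] at h1 h2 ⊢
  rw [h2, mul_assoc (character m₁ x * _), mul_div_assoc, ← h1]
  ring

theorem incrementFactor_ae_ne_zero (n : ℕ) {μ : ℤ} (hμ : μ ≠ 0) :
    ∀ᵐ x ∂normLebesgue, incrementFactor n μ x ≠ 0 :=
  ae_normLebesgue_of_countable (by
    simpa only [not_not] using countable_setOf_incrementFactor_eq_zero n hμ)

/-- The products of the characters with a square integrable function that vanishes almost nowhere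
are total. -/
theorem character_mul_total {F : Measure ℝ} (hF : ∀ᵐ x ∂F, x ∈ Set.Ioo (-Real.pi) Real.pi)
    {g : ℝ → ℂ} (hg0 : ∀ᵐ x ∂F, g x ≠ 0) (hg : ∀ m, MemLp (fun x => character m x * g x) 2 F) :
    (Submodule.span ℂ (Set.range fun m : ℤ => (hg m).toLp _)).topologicalClosure = ⊤ := by
  refine topologicalClosure_span_range_eq_top fun u hu => ?_
  have hu2 := Lp.memLp u
  have hg' : MemLp g 2 F := by simpa only [character_zero, one_mul] using hg 0
  have hint : Integrable (fun x => (starRingEnd ℂ) (g x) * u x) F := by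
    refine (hg'.star).integrable_mul hu2
  have h0 := ae_eq_zero_of_integral_character_mul_eq_zero hF hint fun m => by
    have := hu (-m)
    rw [← Lp.toLp_coeFn u hu2, inner_toLp_toLp] at this
    rw [← this]
    congr 1
    ext x
    rw [map_mul, conj_character, neg_neg, mul_assoc]
  refine Lp.eq_zero_iff_ae_eq_zero.2 ?_
  filter_upwards [h0, hg0] with x h1 h2
  exact (mul_eq_zero.1 h1).resolve_left (by simpa using h2)

theorem incrementKernelLp_total (f : ℝ → ℝ) [IsFiniteMeasure (spectralMeasure f)] (n : ℕ)
    {μ : ℤ} (hμ : μ ≠ 0) :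
    (Submodule.span ℂ (Set.range fun m : ℤ =>
      incrementKernelLp (spectralMeasure f) n m μ)).topologicalClosure = ⊤ :=
  character_mul_total (spectralMeasure_ae_mem_Ioo f)
    ((spectralMeasure_absolutelyContinuous f).ae_le (incrementFactor_ae_ne_zero n hμ))
    fun m => memLp_character_mul_incrementFactor _ n m μ

theorem IsSpectralDensity.exists_isSpectralStochasticMeasure (hf : IsSpectralDensity n Y f) :
    ∃ Z : Set ℝ → Lp ℂ 2 P, IsSpectralStochasticMeasure n Y f Z := by
  have := hf.isFiniteMeasure
  have htot : (Submodule.span ℂ (Set.range fun p : ℤ × ℤ =>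
      incrementKernelLp (spectralMeasure f) n p.1 p.2)).topologicalClosure = ⊤ := by
    refine top_unique ((incrementKernelLp_total f n one_ne_zero).ge.trans ?_)
    refine Submodule.topologicalClosure_mono (Submodule.span_mono ?_)
    rintro _ ⟨m, rfl⟩
    exact ⟨(m, 1), rfl⟩
  obtain ⟨J, hJ⟩ := exists_linearIsometry_of_inner_eq htot
    (w := fun p : ℤ × ℤ => Y p.1 p.2) fun p q => hf.inner_incrementKernelLp _ _ _ _
  obtain ⟨Z, hZ, hJZ⟩ := isOrthogonalStochasticMeasure_of_isometry J
  exact ⟨Z, hZ, fun m μ => (hasStochasticIntegral_iff hJZ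
    (memLp_character_mul_incrementFactor _ n m μ)).2 (hJ (m, μ))⟩

end SpectralRepresentation

/-! The moving average representation in the spectral domain -/

section MovingAverage

variable {P : Measure Ω} {n : ℕ} {Y : ℤ → ℤ → Lp ℂ 2 P} {f : ℝ → ℝ} {ε : ℤ → Lp ℂ 2 P}
  {φ : ℤ → ℕ → ℂ}

theorem memLp_character_mul (m : ℤ) (u : Lp ℂ 2 normLebesgue) :
    MemLp (fun x => character m x * u x) 2 normLebesgue := by
  refine (Lp.memLp u).of_le
    ((measurable_character m).aestronglyMeasurable.mul (Lp.aestronglyMeasurable u))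
    (Eventually.of_forall fun x => ?_)
  rw [norm_mul, norm_character, one_mul]

/-- The function `e^{iλm} Φ(e^{-iλ})` as an element of `L₂(dλ / 2π)`. -/
def shiftedBoundaryLp (φ : ℕ → ℂ) (m : ℤ) : Lp ℂ 2 normLebesgue :=
  (memLp_character_mul m (boundaryFunction φ)).toLp _

/-- Both sides have the same Fourier coefficients: multiplying by e^{iλm} and shifting the series
each move the indices by m. -/
theorem hasSum_shiftedBoundaryLp {φ : ℕ → ℂ} {y : ℤ → Lp ℂ 2 normLebesgue}
    (hy : ∀ m : ℤ, HasSum (fun k : ℕ => φ k • characterLp (m - k)) (y m)) (m : ℤ) :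
    shiftedBoundaryLp φ m = y m := by
  have h0 : boundaryFunction φ = y 0 := by
    rw [← (hy 0).tsum_eq]
    unfold boundaryFunction
    simp only [zero_sub]
    rfl
  have hc : ∀ j, inner ℂ (characterLp j) (y m) = inner ℂ (characterLp (j - m)) (y 0) := by
    intro j
    have h1 := (hy m).mapL (innerSL ℂ (characterLp j))
    have h2 := (hy 0).mapL (innerSL ℂ (characterLp (j - m)))
    refine h1.unique ?_
    rw [← innerSL_apply_apply ℂ (characterLp (j - m))]
    convert h2 using 2 with k
    simp only [innerSL_apply_apply, inner_smul_right,
      orthonormal_iff_ite.1 orthonormal_characterLp]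
    congr 2
    rw [eq_iff_iff]
    omega
  rw [← sub_eq_zero]
  have hz : ∀ j, inner ℂ (characterLp j) (shiftedBoundaryLp φ m - y m) = 0 := by
    intro j
    rw [inner_sub_right, hc, sub_eq_zero, shiftedBoundaryLp, inner_characterLp_left,
      ← Lp.toLp_coeFn (y 0) (Lp.memLp _), inner_characterLp_left, h0]
    congr 1
    ext x
    rw [← mul_assoc, ← character_add]
    congr 2
    ring
  exact eq_zero_of_inner_eq_zero characterLp_total hz

theorem IsCanonicalRepresentation.exists_isometry (hφ : IsCanonicalRepresentation Y ε φ) :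
    ∃ K : Lp ℂ 2 normLebesgue →ₗᵢ[ℂ] Lp ℂ 2 P, (∀ j, K (characterLp j) = ε j) ∧
      ∀ μ : ℤ, 0 < μ → ∀ m, K (shiftedBoundaryLp (φ μ) m) = Y m μ := by
  obtain ⟨K, hK⟩ := exists_linearIsometry_of_inner_eq characterLp_total (w := ε) fun i j => by
    rw [orthonormal_iff_ite.1 orthonormal_characterLp,
      orthonormal_iff_ite.1 hφ.innovation.orthonormal]
  refine ⟨K, hK, fun μ hμ => ?_⟩
  -- The range of K is closed and contains the partial sums, so the moving average can be pulled
  -- back to a convergent series of characters.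
  have hex : ∀ m, ∃ y, K y = Y m μ := fun m => by
    have hcl : IsClosed (Set.range K) := K.isometry.isClosedEmbedding.isClosed_range
    refine hcl.mem_of_tendsto (hφ.hasSum μ hμ m) (Eventually.of_forall fun s => ?_)
    refine ⟨∑ k ∈ s, φ μ k • characterLp (m - k), ?_⟩
    simp [hK]
  choose y hy using hex
  intro m
  rw [hasSum_shiftedBoundaryLp (fun m => ?_) m, hy]
  have h := hφ.hasSum μ hμ m
  rw [← hy] at h
  rw [← K.isometry.isEmbedding.isInducing.hasSum_iff]
  convert h using 2 with k
  simp [hK]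

/-- The inner products of `Y 0 μ` and `Y m μ`, computed in L₂(dλ/2π) and in L₂(F), are the Fourier
coefficients of the two sides. -/
theorem conj_boundaryFunction_mul_ae_eq (hφ : IsCanonicalRepresentation Y ε φ)
    (hf : IsSpectralDensity n Y f) {μ : ℤ} (hμ : 0 < μ) :
    ∀ᵐ x ∂normLebesgue,
      (starRingEnd ℂ) (boundaryFunction (φ μ) x) * boundaryFunction (φ μ) x =
        f x * ((starRingEnd ℂ) (incrementFactor n μ x) * incrementFactor n μ x) := by
  have := hf.isFiniteMeasure
  obtain ⟨K, -, hK⟩ := hφ.exists_isometry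
  have hΦ := Lp.memLp (boundaryFunction (φ μ))
  have hg : MemLp (incrementFactor n μ) 2 (spectralMeasure f) := by
    simpa only [character_zero, one_mul] using
      memLp_character_mul_incrementFactor (spectralMeasure f) n 0 μ
  have hi1 : Integrable (fun x =>
      (starRingEnd ℂ) (boundaryFunction (φ μ) x) * boundaryFunction (φ μ) x) normLebesgue :=
    hΦ.star.integrable_mul hΦ
  have hi2 : Integrable (fun x =>
      f x * ((starRingEnd ℂ) (incrementFactor n μ x) * incrementFactor n μ x)) normLebesgue :=
    (integrable_spectralMeasure_iff hf.measurable hf.nonneg).1 (hg.star.integrable_mul hg)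
  have hbd : ∀ (m : ℤ) {w : ℝ → ℂ}, Integrable w normLebesgue →
      Integrable (fun x => character m x * w x) normLebesgue := fun m w hw =>
    hw.bdd_mul (c := 1) (measurable_character m).aestronglyMeasurable
      (Eventually.of_forall fun x => (norm_character m x).le)
  have h := ae_eq_zero_of_integral_character_mul_eq_zero normLebesgue_ae_mem_Ioo (hi1.sub hi2)
    fun m => by
      have h1 : inner ℂ (shiftedBoundaryLp (φ μ) 0) (shiftedBoundaryLp (φ μ) m) =
          inner ℂ (incrementKernelLp (spectralMeasure f) n 0 μ)
            (incrementKernelLp (spectralMeasure f) n m μ) := by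
        rw [hf.inner_incrementKernelLp, ← hK μ hμ, ← hK μ hμ, K.inner_map_map]
      unfold shiftedBoundaryLp incrementKernelLp at h1
      rw [inner_toLp_toLp, inner_toLp_toLp, integral_spectralMeasure hf.measurable hf.nonneg] at h1
      simp only [Pi.sub_apply, mul_sub]
      rw [integral_sub (hbd m hi1) (hbd m hi2), sub_eq_zero]
      convert h1 using 2
      · ext x
        simp only [character_zero, one_mul]
        ring
      · ext x
        simp only [character_zero, one_mul]
        ring
  filter_upwards [h] with x hx
  exact sub_eq_zero.1 hx

/-- Every Φ_μ vanishes where f does, so the indicator of {f = 0} is orthogonal to all e^{iλm} Φ_μ.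
Its image under K is then orthogonal to the span of Y, which contains all ε_j; hence it is zero. -/
theorem density_ae_ne_zero (hφ : IsCanonicalRepresentation Y ε φ)
    (hf : IsSpectralDensity n Y f) : ∀ᵐ x ∂normLebesgue, f x ≠ 0 := by
  obtain ⟨K, hKε, hK⟩ := hφ.exists_isometry
  have hA : MeasurableSet {x | f x = 0} := hf.measurable (measurableSet_singleton 0)
  set a : Lp ℂ 2 normLebesgue := indicatorLp normLebesgue hA with ha
  have hperp : ∀ y ∈ {y | ∃ m : ℤ, ∃ μ : ℤ, 0 < μ ∧ Y m μ = y}, inner ℂ y (K a) = 0 := by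
    rintro _ ⟨m, μ, hμ, rfl⟩
    rw [← hK μ hμ, K.inner_map_map, L2.inner_def]
    refine integral_eq_zero_of_ae ?_
    filter_upwards [(memLp_character_mul m (boundaryFunction (φ μ))).coeFn_toLp,
      indicatorConstLp_coeFn (p := 2) (hs := hA) (hμs := measure_ne_top normLebesgue _)
        (c := (1 : ℂ)), conj_boundaryFunction_mul_ae_eq hφ hf hμ] with x h1 h2 h3
    rw [shiftedBoundaryLp, h1, ha, indicatorLp, h2]
    by_cases hx : f x = 0
    · rw [hx, Complex.ofReal_zero, zero_mul] at h3
      have : boundaryFunction (φ μ) x = 0 := by simpa using h3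
      simp [this]
    · simp [hx]
  have hεperp : ∀ j, inner ℂ (ε j) (K a) = 0 := fun j => by
    have hmem : ε j ∈ pastSpace Y j := by
      rw [hφ.innovation.past_eq]
      exact Submodule.le_topologicalClosure _ (Submodule.subset_span ⟨j, le_rfl, rfl⟩)
    refine inner_eq_zero_of_mem_topologicalClosure_span ?_ hmem
    rintro y ⟨m, μ, -, hμ, rfl⟩
    exact hperp _ ⟨m, μ, hμ, rfl⟩
  have ha0 : a = 0 := by
    refine eq_zero_of_inner_eq_zero characterLp_total fun j => ?_
    rw [← K.inner_map_map, hKε, hεperp]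
  filter_upwards [Lp.eq_zero_iff_ae_eq_zero.1 ha0,
    indicatorConstLp_coeFn (p := 2) (hs := hA) (hμs := measure_ne_top normLebesgue _)
      (c := (1 : ℂ))] with x h1 h2 hx
  rw [ha, indicatorLp, h2] at h1
  simp [hx] at h1

theorem boundaryFunction_ae_ne_zero (hφ : IsCanonicalRepresentation Y ε φ)
    (hf : IsSpectralDensity n Y f) {μ : ℤ} (hμ : 0 < μ) :
    ∀ᵐ x ∂normLebesgue, boundaryFunction (φ μ) x ≠ 0 := by
  filter_upwards [density_ae_ne_zero hφ hf, conj_boundaryFunction_mul_ae_eq hφ hf hμ,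
    incrementFactor_ae_ne_zero n hμ.ne'] with x h1 h2 h3 h4
  rw [h4] at h2
  simp [h1, h3] at h2

end MovingAverage

/-! The innovations as stochastic integrals -/

section Innovation

variable {P : Measure Ω} {n : ℕ} {Y : ℤ → ℤ → Lp ℂ 2 P} {f : ℝ → ℝ} {ε : ℤ → Lp ℂ 2 P}
  {φ : ℤ → ℕ → ℂ} {Z : Set ℝ → Lp ℂ 2 P}

/-- The kernel `e^{iλj} Φ(e^{-iλ})⁻¹ (1 - e^{-iλμ})^n / (iλ)^n` of the innovation `ε j`. -/
def innovationKernel (n : ℕ) (φ : ℕ → ℂ) (μ j : ℤ) (x : ℝ) : ℂ :=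
  character j x * (boundaryFunction φ x)⁻¹ * incrementFactor n μ x

theorem memLp_innovationKernel (hφ : IsCanonicalRepresentation Y ε φ)
    (hf : IsSpectralDensity n Y f) {μ : ℤ} (hμ : 0 < μ) (j : ℤ) :
    MemLp (innovationKernel n (φ μ) μ j) 2 (spectralMeasure f) := by
  have hmeas : Measurable (innovationKernel n (φ μ) μ j) :=
    ((measurable_character j).mul (Lp.stronglyMeasurable _).measurable.inv).mul
      (measurable_incrementFactor n μ)
  rw [memLp_two_iff_integrable_sq_norm hmeas.aestronglyMeasurable, ← integrable_norm_iff
    (hmeas.norm.pow_const 2).aestronglyMeasurable]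
  have h1 : Integrable (fun x => (‖innovationKernel n (φ μ) μ j x‖ ^ 2 : ℂ))
      (spectralMeasure f) := by
    rw [integrable_spectralMeasure_iff hf.measurable hf.nonneg]
    -- Times f, the squared modulus is f |g_μ|² / |Φ_μ|² = 1 almost everywhere.
    refine (integrable_const (1 : ℂ)).congr ?_
    filter_upwards [conj_boundaryFunction_mul_ae_eq hφ hf hμ,
      boundaryFunction_ae_ne_zero hφ hf hμ] with x h1 h2
    have h2' : (starRingEnd ℂ) (boundaryFunction (φ μ) x) ≠ 0 := by simpa using h2
    have hc : (starRingEnd ℂ) (character j x) * character j x = 1 := by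
      rw [conj_character, ← character_add, neg_add_cancel, character_zero]
    rw [← Complex.conj_mul']
    simp only [innovationKernel, map_mul, map_inv₀]
    field_simp
    linear_combination h1 - f x * (starRingEnd ℂ) (incrementFactor n μ x) *
      incrementFactor n μ x * hc
  refine h1.norm.congr (Eventually.of_forall fun x => ?_)
  simp

/-- The stochastic integral of `e^{iλj} Φ(e^{-iλ})⁻¹ (1 - e^{-iλμ})^n / (iλ)^n` is `ε j`. -/
theorem map_innovationKernel (hφ : IsCanonicalRepresentation Y ε φ)
    (hf : IsSpectralDensity n Y f) [IsFiniteMeasure (spectralMeasure f)]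
    {J : Lp ℂ 2 (spectralMeasure f) →ₗᵢ[ℂ] Lp ℂ 2 P}
    (hJ : ∀ m μ, J (incrementKernelLp (spectralMeasure f) n m μ) = Y m μ)
    {μ : ℤ} (hμ : 0 < μ) (j : ℤ) :
    J ((memLp_innovationKernel hφ hf hμ j).toLp _) = ε j := by
  obtain ⟨K, hKε, hK⟩ := hφ.exists_isometry
  -- Both J and K take values in V, by totality of e^{iλk} g_μ and of e^{iλk} Φ_μ. It is therefore
  -- enough to compare inner products with `Y k μ`.
  set V := (Submodule.span ℂ (Set.range fun k => Y k μ)).topologicalClosure with hV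
  have hVc : IsClosed (V : Set (Lp ℂ 2 P)) := Submodule.isClosed_topologicalClosure _
  have hY : ∀ k, Y k μ ∈ V := fun k =>
    Submodule.le_topologicalClosure _ (Submodule.subset_span ⟨k, rfl⟩)
  have hJV : ∀ a, J a ∈ V := fun a => by
    refine map_mem_of_topologicalClosure J.toContinuousLinearMap hVc
      (s := Set.range fun k => incrementKernelLp (spectralMeasure f) n k μ) ?_
      (incrementKernelLp_total f n hμ.ne' ▸ Submodule.mem_top)
    rintro _ ⟨k, rfl⟩
    change J _ ∈ V
    rw [hJ]
    exact hY k
  have hKV : ∀ a, K a ∈ V := fun a => by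
    refine map_mem_of_topologicalClosure K.toContinuousLinearMap hVc
      (s := Set.range fun k => shiftedBoundaryLp (φ μ) k) ?_
      (character_mul_total normLebesgue_ae_mem_Ioo (boundaryFunction_ae_ne_zero hφ hf hμ)
        (fun m => memLp_character_mul m _) ▸ Submodule.mem_top)
    rintro _ ⟨k, rfl⟩
    change K _ ∈ V
    rw [hK μ hμ]
    exact hY k
  rw [← sub_eq_zero]
  have hd : J ((memLp_innovationKernel hφ hf hμ j).toLp _) - ε j ∈ V :=
    V.sub_mem (hJV _) (hKε j ▸ hKV _)
  refine inner_self_eq_zero.1 (inner_eq_zero_of_mem_topologicalClosure_span ?_ hd)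
  rintro _ ⟨k, rfl⟩
  rw [inner_sub_right, sub_eq_zero]
  simp only
  nth_rewrite 1 [← hJ k μ]
  rw [← hK μ hμ, ← hKε j, J.inner_map_map, K.inner_map_map, incrementKernelLp, shiftedBoundaryLp,
    characterLp, inner_toLp_toLp, inner_toLp_toLp,
    integral_spectralMeasure hf.measurable hf.nonneg]
  refine integral_congr_ae ?_
  filter_upwards [conj_boundaryFunction_mul_ae_eq hφ hf hμ,
    boundaryFunction_ae_ne_zero hφ hf hμ] with x h1 h2
  simp only [innovationKernel, map_mul]
  field_simp
  linear_combination -((starRingEnd ℂ) (character k x) * character j x) * h1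

theorem memLp_spectralCharacteristic_and_map (hφ : IsCanonicalRepresentation Y ε φ)
    (hf : IsSpectralDensity n Y f) [IsFiniteMeasure (spectralMeasure f)]
    {J : Lp ℂ 2 (spectralMeasure f) →ₗᵢ[ℂ] Lp ℂ 2 P}
    (hJ : ∀ m μ, J (incrementKernelLp (spectralMeasure f) n m μ) = Y m μ)
    {μ : ℤ} (hμ : 0 < μ) (m : ℕ) :
    ∃ h : MemLp (fun x => spectralCharacteristic (φ μ) m x * incrementFactor n μ x) 2
        (spectralMeasure f),
      J (h.toLp _) = Y m μ - ∑ k ∈ Finset.range (m + 1), φ μ k • ε (m - k) := by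
  have h1 := memLp_character_mul_incrementFactor (spectralMeasure f) n m μ
  have h2 := fun j => memLp_innovationKernel hφ hf hμ j
  have h3 : ∀ s : Finset ℕ, ∃ h : MemLp (∑ k ∈ s, φ μ k • innovationKernel n (φ μ) μ (m - k)) 2
      (spectralMeasure f), J (h.toLp _) = ∑ k ∈ s, φ μ k • ε (m - k) := by
    intro s
    induction s using Finset.induction_on with
    | empty => exact ⟨MemLp.zero, by simp⟩
    | insert a s ha ih =>
      obtain ⟨h, hs⟩ := ih
      rw [Finset.sum_insert ha, Finset.sum_insert ha]
      refine ⟨((h2 _).const_smul _).add h, ?_⟩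
      rw [MemLp.toLp_add ((h2 _).const_smul _) h, MemLp.toLp_const_smul _ (h2 _), map_add, map_smul, hs,
        map_innovationKernel hφ hf hJ hμ]
  obtain ⟨h, hs⟩ := h3 (Finset.range (m + 1))
  have he : (fun x => spectralCharacteristic (φ μ) m x * incrementFactor n μ x) =
      (fun x => character m x * incrementFactor n μ x) -
        ∑ k ∈ Finset.range (m + 1), φ μ k • innovationKernel n (φ μ) μ (m - k) := by
    ext x
    simp only [Pi.sub_apply, Finset.sum_apply, Pi.smul_apply, smul_eq_mul, innovationKernel,
      spectralCharacteristic, sub_mul, Finset.mul_sum, Finset.sum_mul, sub_eq_add_neg (m : ℤ),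
      character_add]
    congr 1
    refine Finset.sum_congr rfl fun k _ => ?_
    ring
  rw [he]
  refine ⟨h1.sub h, ?_⟩
  rw [MemLp.toLp_sub h1 h, map_sub, hs]
  exact congrArg (· - _) (hJ m μ)

end Innovation

/-! Increments with step `μ` in terms of increments with step `1` -/

section StepPolynomial

open Polynomial

/-- The polynomial `(1 + z + ⋯ + z^{N-1})^n = (1 - z^N)^n / (1 - z)^n`. -/
def stepPolynomial (n N : ℕ) : ℂ[X] := (∑ i ∈ Finset.range N, X ^ i) ^ n

theorem stepPolynomial_mul (n N : ℕ) :
    stepPolynomial n N * (1 - X) ^ n = (1 - X ^ N) ^ n := by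
  unfold stepPolynomial
  rw [← mul_pow, geom_sum_mul_neg]

/-- The backward shift on sequences. -/
def backshift (V : Type*) [AddCommGroup V] [Module ℂ V] : Module.End ℂ (ℤ → V) :=
  LinearMap.funLeft ℂ V fun m => m - 1

theorem backshift_pow_apply {V : Type*} [AddCommGroup V] [Module ℂ V] (x : ℤ → V) (i : ℕ)
    (m : ℤ) : (backshift V ^ i) x m = x (m - i) := by
  induction i generalizing m with
  | zero => simp
  | succ i ih =>
    rw [pow_succ', Module.End.mul_apply]
    change (backshift V ^ i) x (m - 1) = _
    rw [ih]
    congr 1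
    push_cast
    ring

theorem aeval_backshift_apply {V : Type*} [AddCommGroup V] [Module ℂ V] (x : ℤ → V)
    (q : ℂ[X]) (m : ℤ) : aeval (backshift V) q x m =
      ∑ i ∈ Finset.range (q.natDegree + 1), q.coeff i • x (m - i) := by
  rw [aeval_eq_sum_range, LinearMap.sum_apply, Finset.sum_apply]
  simp only [LinearMap.smul_apply, Pi.smul_apply, backshift_pow_apply]

theorem increment_eq_aeval_backshift {α : Type*} (n N : ℕ) (ξ : ℤ → α → ℂ) (m : ℤ) :
    increment n ξ m N = aeval (backshift (α → ℂ)) ((1 - X ^ N) ^ n : ℂ[X]) ξ m := by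
  have h : ((1 - X ^ N) ^ n : ℂ[X]) = ∑ l ∈ Finset.range (n + 1),
      ((-1 : ℂ) ^ l * (n.choose l : ℂ)) • X ^ (N * l) := by
    rw [sub_eq_neg_add, add_pow]
    refine Finset.sum_congr rfl fun l _ => ?_
    rw [one_pow, mul_one, neg_pow, ← pow_mul, smul_eq_C_mul]
    simp only [map_mul, map_pow, map_neg, map_one, map_natCast]
    ring
  rw [h, map_sum, LinearMap.sum_apply, Finset.sum_apply]
  ext a
  simp only [map_smul, map_pow, aeval_X, Finset.sum_apply, LinearMap.smul_apply, increment]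
  refine Finset.sum_congr rfl fun l _ => ?_
  rw [Pi.smul_apply, Pi.smul_apply, backshift_pow_apply,
    smul_eq_mul]
  congr 3
  push_cast
  ring

/-- The increments of steps N and 1 come from applying (1 - z^N)^n and (1 - z)^n to the backshift,
and the first polynomial is a multiple of the second. -/
theorem increment_eq_sum {α : Type*} (n N : ℕ) (ξ : ℤ → α → ℂ) (m : ℤ) :
    increment n ξ m N = ∑ i ∈ Finset.range ((stepPolynomial n N).natDegree + 1),
      (stepPolynomial n N).coeff i • increment n ξ (m - i) 1 := by
  have h1 : ∀ m, increment n ξ m 1 =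
      aeval (backshift (α → ℂ)) ((1 - X) ^ n : ℂ[X]) ξ m := fun m => by
    have := increment_eq_aeval_backshift n 1 ξ m
    rwa [pow_one, Nat.cast_one] at this
  rw [increment_eq_aeval_backshift, ← stepPolynomial_mul, map_mul, Module.End.mul_apply,
    aeval_backshift_apply]
  simp only [h1]

theorem incrementLp_eq_sum {P : Measure Ω} {n : ℕ} {ξ : ℤ → Ω → ℂ}
    (hξ : HasStationaryIncrements P n ξ) (N : ℕ) (m : ℤ) :
    incrementLp hξ m N = ∑ i ∈ Finset.range ((stepPolynomial n N).natDegree + 1),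
      (stepPolynomial n N).coeff i • incrementLp hξ (m - i) 1 := by
  refine Lp.ext ?_
  refine (hξ.memLp m N).coeFn_toLp.trans (.symm ?_)
  refine (Lp.coeFn_finsetSum _ _).trans ?_
  have h1 : ∀ᵐ ω ∂P, ∀ i ∈ Finset.range ((stepPolynomial n N).natDegree + 1),
      ((stepPolynomial n N).coeff i • incrementLp hξ (m - i) 1 : Lp ℂ 2 P) ω =
        (stepPolynomial n N).coeff i * increment n ξ (m - i) 1 ω := by
    refine (Finset.eventually_all _).2 fun i _ => ?_
    filter_upwards [Lp.coeFn_smul ((stepPolynomial n N).coeff i) (incrementLp hξ (m - i) 1),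
      (hξ.memLp (m - i) 1).coeFn_toLp] with ω h2 h3
    rw [h2, Pi.smul_apply, incrementLp, h3, smul_eq_mul]
  filter_upwards [h1] with ω hω
  rw [Finset.sum_apply, Finset.sum_congr rfl hω, increment_eq_sum, Finset.sum_apply]
  simp only [Pi.smul_apply, smul_eq_mul]

end StepPolynomial

/-! ### Invariance of the Gram matrices under the time shift -/

theorem HasStationaryIncrements.inner_shift {P : Measure Ω} {n : ℕ} {ξ : ℤ → Ω → ℂ}
    (hξ : HasStationaryIncrements P n ξ) (m₁ m₂ μ₁ μ₂ : ℤ) :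
    inner ℂ (incrementLp hξ (m₂ - 1) μ₂) (incrementLp hξ (m₁ - 1) μ₁) =
      inner ℂ (incrementLp hξ m₂ μ₂) (incrementLp hξ m₁ μ₁) := by
  obtain ⟨D, hD⟩ := hξ.structural
  have key : ∀ m₁ m₂, inner ℂ (incrementLp hξ m₂ μ₂) (incrementLp hξ m₁ μ₁) =
      D (m₁ - m₂) μ₁ μ₂ := fun m₁ m₂ => by
    rw [← hD m₂, add_sub_cancel, incrementLp, incrementLp, L2.inner_def]
    refine integral_congr_ae ?_
    filter_upwards [(hξ.memLp m₁ μ₁).coeFn_toLp, (hξ.memLp m₂ μ₂).coeFn_toLp] with ω h1 h2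
    rw [h1, h2, RCLike.inner_apply]
  rw [key, key, sub_sub_sub_cancel_right]

theorem IsSpectralDensity.inner_shift {P : Measure Ω} {n : ℕ} {Y : ℤ → ℤ → Lp ℂ 2 P} {f : ℝ → ℝ}
    (hf : IsSpectralDensity n Y f) (m₁ m₂ μ₁ μ₂ : ℤ) :
    inner ℂ (Y (m₂ - 1) μ₂) (Y (m₁ - 1) μ₁) = inner ℂ (Y m₂ μ₂) (Y m₁ μ₁) := by
  have h1 := hf.structural m₂ (m₁ - m₂) μ₁ μ₂
  have h2 := hf.structural (m₂ - 1) (m₁ - m₂) μ₁ μ₂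
  rw [add_sub_cancel] at h1
  rw [h1, ← h2]
  congr 2
  ring

/-! Singular and regular parts -/

section WoldDecomposition

variable {P : Measure Ω} {X : ℤ → ℤ → Lp ℂ 2 P} {ε : ℤ → Lp ℂ 2 P}

theorem pastSpace_isClosed (X : ℤ → ℤ → Lp ℂ 2 P) (t : ℤ) :
    IsClosed (pastSpace X t : Set (Lp ℂ 2 P)) := Submodule.isClosed_topologicalClosure _

theorem mem_pastSpace {m μ t : ℤ} (hm : m ≤ t) (hμ : 0 < μ) : X m μ ∈ pastSpace X t :=
  Submodule.le_topologicalClosure _ (Submodule.subset_span ⟨m, μ, hm, hμ, rfl⟩)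

theorem stepPastSpace_isClosed (X : ℤ → ℤ → Lp ℂ 2 P) (μ t : ℤ) :
    IsClosed (stepPastSpace X μ t : Set (Lp ℂ 2 P)) := Submodule.isClosed_topologicalClosure _

theorem mem_stepPastSpace {m μ t : ℤ} (hm : m ≤ t) : X m μ ∈ stepPastSpace X μ t :=
  Submodule.le_topologicalClosure _ (Submodule.subset_span ⟨m, hm, rfl⟩)

theorem stepPastSpace_le_pastSpace {μ t : ℤ} (hμ : 0 < μ) :
    stepPastSpace X μ t ≤ pastSpace X t :=
  Submodule.topologicalClosure_mono (Submodule.span_mono fun _ ⟨m, hm, h⟩ => ⟨m, μ, hm, hμ, h⟩)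

theorem singularPart_mem (X : ℤ → ℤ → Lp ℂ 2 P) (m μ : ℤ) : singularPart X m μ ∈ remotePast X :=
  Submodule.starProjection_apply_mem _ _

theorem remotePast_le (X : ℤ → ℤ → Lp ℂ 2 P) (t : ℤ) : remotePast X ≤ pastSpace X t :=
  iInf_le _ t

theorem singularPart_add_regularPart (X : ℤ → ℤ → Lp ℂ 2 P) (m μ : ℤ) :
    singularPart X m μ + regularPart X m μ = X m μ := add_sub_cancel _ _

theorem inner_regularPart_eq_zero {s : Lp ℂ 2 P} (hs : s ∈ remotePast X) (m μ : ℤ) :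
    inner ℂ (regularPart X m μ) s = 0 :=
  Submodule.starProjection_inner_eq_zero _ _ hs

theorem pastSpace_regularPart_le (t : ℤ) : pastSpace (regularPart X) t ≤ pastSpace X t := by
  refine Submodule.topologicalClosure_minimal _ (Submodule.span_le.2 ?_) (pastSpace_isClosed X t)
  rintro _ ⟨m, μ, hm, hμ, rfl⟩
  exact (pastSpace X t).sub_mem (mem_pastSpace hm hμ) (remotePast_le X t (singularPart_mem X m μ))

theorem IsInnovation.mem_pastSpace {Y : ℤ → ℤ → Lp ℂ 2 P} (h : IsInnovation Y ε) {j t : ℤ}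
    (hj : j ≤ t) : ε j ∈ pastSpace Y t := by
  rw [h.past_eq]
  exact Submodule.le_topologicalClosure _ (Submodule.subset_span ⟨j, hj, rfl⟩)

theorem IsInnovation.inner_remotePast_eq_zero (h : IsInnovation (regularPart X) ε) (j : ℤ)
    {s : Lp ℂ 2 P} (hs : s ∈ remotePast X) : inner ℂ (ε j) s = 0 := by
  refine inner_eq_zero_of_mem_topologicalClosure_span ?_ (h.mem_pastSpace le_rfl)
  rintro _ ⟨m, μ, -, -, rfl⟩
  exact inner_regularPart_eq_zero hs m μ

theorem IsInnovation.inner_pastSpace_eq_zero (h : IsInnovation (regularPart X) ε) {j t : ℤ}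
    (hj : t < j) {y : Lp ℂ 2 P} (hy : y ∈ pastSpace X t) : inner ℂ y (ε j) = 0 := by
  refine inner_eq_zero_of_mem_topologicalClosure_span ?_ hy
  rintro _ ⟨m, μ, hm, hμ, rfl⟩
  have h1 : inner ℂ (regularPart X m μ) (ε j) = 0 := by
    have hmem : regularPart X m μ ∈ pastSpace (regularPart X) t :=
      StatIncr.mem_pastSpace hm hμ
    rw [h.past_eq] at hmem
    refine inner_eq_zero_of_mem_topologicalClosure_span ?_ hmem
    rintro _ ⟨k, hk, rfl⟩
    exact h.orthonormal.2 (by omega)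
  rw [← singularPart_add_regularPart X m μ, inner_add_left, h1, add_zero, inner_eq_zero_symm]
  exact h.inner_remotePast_eq_zero j (singularPart_mem X m μ)

theorem inner_eq_inner_singularPart_add (X : ℤ → ℤ → Lp ℂ 2 P) (m₁ m₂ μ₁ μ₂ : ℤ) :
    inner ℂ (X m₂ μ₂) (X m₁ μ₁) = inner ℂ (singularPart X m₂ μ₂) (singularPart X m₁ μ₁) +
      inner ℂ (regularPart X m₂ μ₂) (regularPart X m₁ μ₁) := by
  have h1 := inner_regularPart_eq_zero (singularPart_mem X m₁ μ₁) m₂ μ₂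
  have h2 := inner_eq_zero_symm.1 (inner_regularPart_eq_zero (singularPart_mem X m₂ μ₂) m₁ μ₁)
  conv_lhs => rw [← singularPart_add_regularPart X m₂ μ₂, ← singularPart_add_regularPart X m₁ μ₁,
    inner_add_left, inner_add_right, inner_add_right, h1, h2, add_zero, zero_add]

/-- The backward shift of the singular part and of the innovations. -/
theorem exists_shift {φ : ℤ → ℕ → ℂ} (hφ : IsCanonicalRepresentation (regularPart X) ε φ)
    (hX : ∀ m₁ m₂ μ₁ μ₂, inner ℂ (X (m₂ - 1) μ₂) (X (m₁ - 1) μ₁) =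
      inner ℂ (X m₂ μ₂) (X m₁ μ₁))
    (hY : ∀ m₁ m₂ μ₁ μ₂, inner ℂ (regularPart X (m₂ - 1) μ₂) (regularPart X (m₁ - 1) μ₁) =
      inner ℂ (regularPart X m₂ μ₂) (regularPart X m₁ μ₁)) :
    ∃ B : Lp ℂ 2 P →L[ℂ] Lp ℂ 2 P, (∀ j, B (ε j) = ε (j - 1)) ∧
      (∀ m μ, B (singularPart X m μ) = singularPart X (m - 1) μ) ∧
      ∀ m μ, 0 < μ → B (X m μ) = X (m - 1) μ := by
  have hinn := hφ.innovation
  -- The Gram matrix of the singular parts is that of X minus that of the regular parts, both shift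
  -- invariant; singular parts and innovations are mutually orthogonal.
  obtain ⟨B, hB⟩ := exists_continuousLinearMap_of_inner_eq
    (v := Sum.elim (fun p : ℤ × ℤ => singularPart X p.1 p.2) ε)
    (w := Sum.elim (fun p : ℤ × ℤ => singularPart X (p.1 - 1) p.2) fun j => ε (j - 1)) <| by
    rintro (⟨m₂, μ₂⟩ | i) (⟨m₁, μ₁⟩ | j)
    · have h1 := inner_eq_inner_singularPart_add X m₁ m₂ μ₁ μ₂
      have h2 := inner_eq_inner_singularPart_add X (m₁ - 1) (m₂ - 1) μ₁ μ₂
      rw [hX, hY, h1] at h2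
      exact add_right_cancel h2
    · simp only [Sum.elim_inl, Sum.elim_inr]
      rw [inner_eq_zero_symm.1 (hinn.inner_remotePast_eq_zero j (singularPart_mem X m₂ μ₂)),
        inner_eq_zero_symm.1 (hinn.inner_remotePast_eq_zero _ (singularPart_mem X (m₂ - 1) μ₂))]
    · simp only [Sum.elim_inl, Sum.elim_inr]
      rw [hinn.inner_remotePast_eq_zero _ (singularPart_mem X _ _),
        hinn.inner_remotePast_eq_zero _ (singularPart_mem X _ _)]
    · simp only [Sum.elim_inr]
      rw [orthonormal_iff_ite.1 hinn.orthonormal, orthonormal_iff_ite.1 hinn.orthonormal]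
      simp
  have hε : ∀ j, B (ε j) = ε (j - 1) := fun j => hB (Sum.inr j)
  have hS : ∀ m μ, B (singularPart X m μ) = singularPart X (m - 1) μ :=
    fun m μ => hB (Sum.inl (m, μ))
  refine ⟨B, hε, hS, fun m μ hμ => ?_⟩
  have hreg : B (regularPart X m μ) = regularPart X (m - 1) μ := by
    refine ((hφ.hasSum μ hμ m).mapL B).unique ?_
    convert hφ.hasSum μ hμ (m - 1) using 2 with k
    rw [map_smul, hε]
    congr 2
    ring
  rw [← singularPart_add_regularPart X m μ, map_add, hS, hreg, singularPart_add_regularPart]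

end WoldDecomposition

/-! The past of the increments with one fixed step -/

section StepPast

variable {P : Measure Ω} {X : ℤ → ℤ → Lp ℂ 2 P} {ε : ℤ → Lp ℂ 2 P} {n : ℕ}

theorem iterate_apply_of_shift {V : Type*} [NormedAddCommGroup V] [NormedSpace ℂ V]
    {x : ℤ → V} {B : V →L[ℂ] V} (h : ∀ m, B (x m) = x (m - 1)) (i : ℕ) (m : ℤ) :
    (B ^ i) (x m) = x (m - i) := by
  induction i with
  | zero => simp
  | succ i ih =>
    rw [pow_succ', ContinuousLinearMap.mul_def, ContinuousLinearMap.comp_apply, ih, h]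
    congr 1
    push_cast
    ring

open Polynomial in
theorem aeval_apply_of_shift {V : Type*} [NormedAddCommGroup V] [NormedSpace ℂ V]
    {x : ℤ → V} {B : V →L[ℂ] V} (h : ∀ m, B (x m) = x (m - 1)) (q : ℂ[X]) (m : ℤ) :
    aeval B q (x m) = ∑ i ∈ Finset.range (q.natDegree + 1), q.coeff i • x (m - i) := by
  rw [aeval_eq_sum_range, sum_apply]
  simp only [smul_apply, iterate_apply_of_shift h]

/-- Vectors whose differences `A (ε j) - A (ε (j - μ))` lie in a closed subspace, where `A` is
bounded and `ε` orthonormal, lie in it themselves. -/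
theorem mem_of_sub_mem_of_orthonormal {H : Type*} [NormedAddCommGroup H] [InnerProductSpace ℂ H]
    [CompleteSpace H] {ε : ℤ → H} (hε : Orthonormal ℂ ε) (A : H →L[ℂ] H) {W : Submodule ℂ H}
    (hW : IsClosed (W : Set H)) {μ : ℤ} (hμ : 0 < μ) {t : ℤ}
    (h : ∀ j ≤ t, A (ε j) - A (ε (j - μ)) ∈ W) {j : ℤ} (hj : j ≤ t) : A (ε j) ∈ W := by
  have : CompleteSpace W := hW.completeSpace_coe
  rw [← Submodule.orthogonal_orthogonal W, Submodule.mem_orthogonal]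
  intro u hu
  -- For u orthogonal to W these products do not depend on i; they are also, up to conjugation,
  -- coefficients of A* u in an orthonormal sequence, so by Bessel they tend to 0.
  have hconst : ∀ i : ℕ, inner ℂ u (A (ε (j - i * μ))) = inner ℂ u (A (ε j)) := by
    intro i
    induction i with
    | zero => simp
    | succ i ih =>
      have hle : j - i * μ ≤ t := by nlinarith
      have h0 := (Submodule.mem_orthogonal' _ _).1 hu _ (h _ hle)
      rw [inner_sub_right, sub_eq_zero, ih] at h0
      rw [h0]
      congr 3
      push_cast
      ring
  have hinj : Function.Injective fun i : ℕ => j - i * μ := fun a b hab => by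
    have h1 : (a : ℤ) * μ = b * μ := by
      simp only at hab
      linarith
    exact_mod_cast mul_right_cancel₀ hμ.ne' h1
  have hsum := (hε.comp _ hinj).inner_products_summable (ContinuousLinearMap.adjoint A u)
  have hlim := hsum.tendsto_atTop_zero
  have hc : ∀ i : ℕ, ‖inner ℂ ((ε ∘ fun i : ℕ => j - i * μ) i)
      (ContinuousLinearMap.adjoint A u)‖ ^ 2 = ‖inner ℂ u (A (ε j))‖ ^ 2 := fun i => by
    rw [ContinuousLinearMap.adjoint_inner_right, Function.comp_apply, norm_inner_symm, hconst]
  simp only [hc] at hlim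
  have := tendsto_nhds_unique tendsto_const_nhds hlim
  simpa using this

/-- The operator T = q(B), with q the step polynomial, carries the past of all steps into the past
of step N. -/
theorem singularPart_mem_and_innovation_mem_stepPastSpace {N : ℕ} (hN : 0 < N)
    (hε : Orthonormal ℂ ε) (hεpast : ∀ j ≤ (-1 : ℤ), ε j ∈ pastSpace X (-1))
    {B : Lp ℂ 2 P →L[ℂ] Lp ℂ 2 P} (hBε : ∀ j, B (ε j) = ε (j - 1))
    (hBS : ∀ m μ, B (singularPart X m μ) = singularPart X (m - 1) μ)
    (hBX : ∀ m μ, 0 < μ → B (X m μ) = X (m - 1) μ)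
    (hX : ∀ (N : ℕ) (m : ℤ), X m N =
      ∑ i ∈ Finset.range ((stepPolynomial n N).natDegree + 1),
        (stepPolynomial n N).coeff i • X (m - i) 1) :
    (∀ m, singularPart X m N ∈ stepPastSpace X N (-1)) ∧
      ∀ j ≤ (-1 : ℤ), ε j ∈ stepPastSpace X N (-1) := by
  set W := stepPastSpace X N (-1) with hWdef
  have hW : IsClosed (W : Set (Lp ℂ 2 P)) := stepPastSpace_isClosed X N (-1)
  set T : Lp ℂ 2 P →L[ℂ] Lp ℂ 2 P := Polynomial.aeval B (stepPolynomial n N) with hT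
  have hTX : ∀ m, T (X m 1) = X m N := fun m => by
    rw [hT, aeval_apply_of_shift (x := fun m => X m 1) (fun m => hBX m 1 one_pos), hX]
  have hTS : ∀ m, T (singularPart X m 1) = singularPart X m N := fun m => by
    rw [hT, aeval_apply_of_shift (x := fun m => singularPart X m 1)
      (fun m => hBS m 1)]
    simp only [singularPart]
    rw [hX N m, map_sum]
    simp only [map_smul]
  -- Any X(m, M) combines the X(m - i, 1), which T sends to X(m - i, N).
  have hTpast : ∀ y ∈ pastSpace X (-1), T y ∈ W := by
    intro y hy
    refine map_mem_of_topologicalClosure T hW ?_ hy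
    rintro _ ⟨m, μ, hm, hμ, rfl⟩
    obtain ⟨M, rfl⟩ := Int.eq_ofNat_of_zero_le hμ.le
    rw [hX M m, map_sum]
    refine W.sum_mem fun i _ => ?_
    rw [map_smul, hTX]
    exact W.smul_mem _ (mem_stepPastSpace (by omega))
  refine ⟨fun m => ?_, ?_⟩
  · rw [← hTS]
    exact hTpast _ (remotePast_le X _ (singularPart_mem X m 1))
  -- Each induction step strips one factor 1 - B^N, with A = (1 - B^N)^r.
  have hstep : ∀ r : ℕ, (∀ j ≤ (-1 : ℤ),
      Polynomial.aeval B ((1 - Polynomial.X ^ N) ^ r : Polynomial ℂ) (ε j) ∈ W) →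
      ∀ j ≤ (-1 : ℤ), ε j ∈ W := by
    intro r
    induction r with
    | zero =>
      intro h j hj
      simpa using h j hj
    | succ r ih =>
      intro h
      refine ih fun j hj => ?_
      refine mem_of_sub_mem_of_orthonormal hε _ hW (μ := N) (by exact_mod_cast hN) ?_ hj
      intro j hj
      have := h j hj
      rw [pow_succ, map_mul, ContinuousLinearMap.mul_def, ContinuousLinearMap.comp_apply, map_sub, map_one,
        map_pow _ Polynomial.X N,
        Polynomial.aeval_X, sub_apply, one_apply_eq_self,
        iterate_apply_of_shift hBε, map_sub] at this
      exact this
  refine hstep n fun j hj => ?_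
  rw [← stepPolynomial_mul, map_mul, ContinuousLinearMap.mul_def, ContinuousLinearMap.comp_apply,
    aeval_apply_of_shift hBε]
  refine hTpast _ (Submodule.sum_mem _ fun i _ => Submodule.smul_mem _ _ (hεpast _ (by omega)))

end StepPast

/-! Optimal estimates -/

section OptimalEstimate

variable {P : Measure Ω}

theorem meanSquareError_eq (η e : Lp ℂ 2 P) : meanSquareError η e = ‖η - e‖ ^ 2 := by
  have h : ((‖η - e‖ ^ 2 : ℝ) : ℂ) = ((meanSquareError η e : ℝ) : ℂ) := by
    have h1 := inner_self_eq_norm_sq_to_K (𝕜 := ℂ) (η - e)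
    rw [L2.inner_def] at h1
    push_cast
    rw [meanSquareError, ← integral_complex_ofReal]
    refine h1.symm.trans (integral_congr_ae ?_)
    filter_upwards [Lp.coeFn_sub η e] with ω hω
    rw [hω, Pi.sub_apply, inner_self_eq_norm_sq_to_K]
    norm_cast
  exact_mod_cast h.symm

/-- By Pythagoras any other y in K has error larger by ‖e - y‖². -/
theorem isOptimalEstimate_iff {K : Submodule ℂ (Lp ℂ 2 P)} {η e : Lp ℂ 2 P} (he : e ∈ K)
    (h : ∀ y ∈ K, inner ℂ y (η - e) = 0) (e' : Lp ℂ 2 P) :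
    IsOptimalEstimate K η e' ↔ e' = e := by
  have key : ∀ y ∈ K, meanSquareError η y = meanSquareError η e + ‖e - y‖ ^ 2 := by
    intro y hy
    have h0 : inner ℂ (η - e) (e - y) = 0 := inner_eq_zero_symm.1 (h _ (K.sub_mem he hy))
    have := norm_add_sq_eq_norm_sq_add_norm_sq_of_inner_eq_zero (𝕜 := ℂ) _ _ h0
    rw [sub_add_sub_cancel] at this
    rw [meanSquareError_eq, meanSquareError_eq, sq, sq, sq, this]
  constructor
  · rintro ⟨he', hle⟩
    have h1 := hle e he
    rw [key e' he'] at h1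
    have h2 : ‖e - e'‖ ^ 2 ≤ 0 := by linarith
    have h3 : ‖e - e'‖ = 0 := by
      have := sq_nonneg ‖e - e'‖
      exact pow_eq_zero_iff two_ne_zero |>.1 (le_antisymm h2 this)
    exact (sub_eq_zero.1 (norm_eq_zero.1 h3)).symm
  · rintro rfl
    refine ⟨he, fun y hy => ?_⟩
    rw [key y hy]
    exact le_add_of_nonneg_right (sq_nonneg _)

theorem norm_sq_sum_of_orthonormal {H ι : Type*} [NormedAddCommGroup H] [InnerProductSpace ℂ H]
    {v : ι → H} (hv : Orthonormal ℂ v) (a : ι → ℂ) (s : Finset ι) :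
    ‖∑ k ∈ s, a k • v k‖ ^ 2 = ∑ k ∈ s, ‖a k‖ ^ 2 := by
  have h := hv.inner_sum a a s
  rw [inner_self_eq_norm_sq_to_K] at h
  simp only [Complex.conj_mul'] at h
  refine Complex.ofReal_injective ?_
  push_cast
  exact h

theorem integral_norm_sq_trigonometricPolynomial (a : ℕ → ℂ) (m : ℕ) :
    (2 * Real.pi)⁻¹ * ∫ x in (-Real.pi)..Real.pi,
      ‖∑ k ∈ Finset.range (m + 1), a k * character (-(k : ℤ)) x‖ ^ 2 =
        ∑ k ∈ Finset.range (m + 1), ‖a k‖ ^ 2 := by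
  have hinj : Function.Injective fun k : ℕ => -(k : ℤ) := fun i j h => by simpa using h
  rw [← norm_sq_sum_of_orthonormal (orthonormal_characterLp.comp _ hinj) a]
  set u : Lp ℂ 2 normLebesgue := ∑ k ∈ Finset.range (m + 1), a k •
    (characterLp ∘ fun k : ℕ => -(k : ℤ)) k with hu
  have hae : u =ᵐ[normLebesgue]
      fun x => ∑ k ∈ Finset.range (m + 1), a k * character (-(k : ℤ)) x := by
    refine (Lp.coeFn_finsetSum _ _).trans ?_
    have h1 : ∀ᵐ x ∂normLebesgue, ∀ k ∈ Finset.range (m + 1),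
        (a k • characterLp (-(k : ℤ)) : Lp ℂ 2 normLebesgue) x =
          a k * character (-(k : ℤ)) x := by
      refine (Finset.eventually_all _).2 fun k _ => ?_
      filter_upwards [Lp.coeFn_smul (a k) (characterLp (-(k : ℤ))),
        (character_memLp (-(k : ℤ))).coeFn_toLp] with x h2 h3
      rw [h2, Pi.smul_apply, characterLp, h3, smul_eq_mul]
    filter_upwards [h1] with x hx
    rw [Finset.sum_apply]
    exact Finset.sum_congr rfl hx
  have h : ((‖u‖ ^ 2 : ℝ) : ℂ) = (((2 * Real.pi)⁻¹ * ∫ x in (-Real.pi)..Real.pi,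
      ‖∑ k ∈ Finset.range (m + 1), a k * character (-(k : ℤ)) x‖ ^ 2 : ℝ) : ℂ) := by
    have h1 := inner_self_eq_norm_sq_to_K (𝕜 := ℂ) u
    rw [L2.inner_def] at h1
    rw [Complex.ofReal_mul, ← intervalIntegral.integral_ofReal, ← Complex.real_smul,
      ← integral_normLebesgue]
    push_cast
    refine h1.symm.trans (integral_congr_ae ?_)
    filter_upwards [hae] with x hx
    rw [hx, inner_self_eq_norm_sq_to_K]
    norm_cast
  exact_mod_cast h.symm

end OptimalEstimate

end StatIncr

end

/-- `ξ` has stationary `n`-th increments with mean zero, `ε` and `φ` give the canonical moving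
average representation of their regular component, `f` is its spectral density.

First, the orthogonal stochastic measure of the spectral representation exists. Second, for every
such measure `Z` and all `m ≥ 0`, `μ > 0`: the function `Φ_μ(e^{-iλ})` vanishes almost nowhere, and
there is an element `e = ξ_s⁽ⁿ⁾(m, μ) + ∫ h_{m,μ}(λ) (1 - e^{-iλμ})^n (iλ)^{-n} dZ(λ)` that is
the unique optimal linear estimate of `ξ⁽ⁿ⁾(m, μ)`, both from the increments `ξ⁽ⁿ⁾(k, ν)`,
`k ≤ -1`, of all steps `ν > 0` and from those of step `μ` alone; its mean square error is
`(2π)⁻¹ ∫ |∑_{k ≤ m} φ_μ(k) e^{-iλk}|² dλ = ∑_{k ≤ m} |φ_μ(k)|²`. -/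
theorem corollary3p1 {Ω : Type*} [MeasurableSpace Ω] (P : Measure Ω) [IsProbabilityMeasure P]
    (n : ℕ) (ξ : ℤ → Ω → ℂ) (hξ : StatIncr.HasStationaryIncrements P n ξ)
    (hmean : ∀ m μ : ℤ, ∫ ω, StatIncr.increment n ξ m μ ω ∂P = 0)
    (ε : ℤ → Lp ℂ 2 P) (φ : ℤ → ℕ → ℂ)
    (hφ : StatIncr.IsCanonicalRepresentation
      (StatIncr.regularPart (StatIncr.incrementLp hξ)) ε φ)
    (f : ℝ → ℝ)
    (hf : StatIncr.IsSpectralDensity n (StatIncr.regularPart (StatIncr.incrementLp hξ)) f) :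
    (∃ Z : Set ℝ → Lp ℂ 2 P, StatIncr.IsSpectralStochasticMeasure n
      (StatIncr.regularPart (StatIncr.incrementLp hξ)) f Z) ∧
    ∀ Z : Set ℝ → Lp ℂ 2 P, StatIncr.IsSpectralStochasticMeasure n
      (StatIncr.regularPart (StatIncr.incrementLp hξ)) f Z →
    ∀ (m : ℕ) (μ : ℤ), 0 < μ →
      (∀ᵐ x ∂StatIncr.normLebesgue, StatIncr.boundaryFunction (φ μ) x ≠ 0) ∧
      ∃ e : Lp ℂ 2 P,
        StatIncr.HasStochasticIntegral (StatIncr.spectralMeasure f) Z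
          (fun x => StatIncr.spectralCharacteristic (φ μ) m x * StatIncr.incrementFactor n μ x)
          (e - StatIncr.singularPart (StatIncr.incrementLp hξ) m μ) ∧
        (∀ e' : Lp ℂ 2 P, StatIncr.IsOptimalEstimate
          (StatIncr.pastSpace (StatIncr.incrementLp hξ) (-1))
          (StatIncr.incrementLp hξ m μ) e' ↔ e' = e) ∧
        (∀ e' : Lp ℂ 2 P, StatIncr.IsOptimalEstimate
          (StatIncr.stepPastSpace (StatIncr.incrementLp hξ) μ (-1))
          (StatIncr.incrementLp hξ m μ) e' ↔ e' = e) ∧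
        StatIncr.meanSquareError (StatIncr.incrementLp hξ m μ) e =
          (2 * Real.pi)⁻¹ * ∫ x in (-Real.pi)..Real.pi,
            ‖∑ k ∈ Finset.range (m + 1), φ μ k * StatIncr.character (-(k : ℤ)) x‖ ^ 2 ∧
        StatIncr.meanSquareError (StatIncr.incrementLp hξ m μ) e =
          ∑ k ∈ Finset.range (m + 1), ‖φ μ k‖ ^ 2 := by

  have hinn := hφ.innovation
  have hfin := hf.isFiniteMeasure
  refine ⟨hf.exists_isSpectralStochasticMeasure, fun Z hZ m μ hμ =>
    ⟨StatIncr.boundaryFunction_ae_ne_zero hφ hf hμ, ?_⟩⟩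
  obtain ⟨J, hJZ⟩ := StatIncr.exists_isometry_of_isOrthogonalStochasticMeasure hZ.orthogonal
  have hJ : ∀ m μ, J (StatIncr.incrementKernelLp (StatIncr.spectralMeasure f) n m μ) =
      StatIncr.regularPart (StatIncr.incrementLp hξ) m μ := fun m μ =>
    (StatIncr.hasStochasticIntegral_iff hJZ _).1 (hZ.representation m μ)
  obtain ⟨hmem, hmap⟩ := StatIncr.memLp_spectralCharacteristic_and_map hφ hf hJ hμ m
  obtain ⟨B, hBε, hBS, hBX⟩ := StatIncr.exists_shift hφ hξ.inner_shift hf.inner_shift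
  set X := StatIncr.incrementLp hξ with hX
  -- The prediction error: the part of the moving average carried by innovations of times 0, …, m.
  set δ : Lp ℂ 2 P := ∑ k ∈ Finset.range (m + 1), φ μ k • ε (m - k) with hδ
  have hW : (∀ m, StatIncr.singularPart X m μ ∈ StatIncr.stepPastSpace X μ (-1)) ∧
      ∀ j ≤ (-1 : ℤ), ε j ∈ StatIncr.stepPastSpace X μ (-1) := by
    obtain ⟨N, rfl⟩ := Int.eq_ofNat_of_zero_le hμ.le
    exact StatIncr.singularPart_mem_and_innovation_mem_stepPastSpace (by exact_mod_cast hμ)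
      hinn.orthonormal
      (fun j hj => StatIncr.pastSpace_regularPart_le (-1) (hinn.mem_pastSpace hj))
      hBε hBS hBX (StatIncr.incrementLp_eq_sum hξ)
  -- The remaining terms have k ≥ m + 1, that is, innovation times m - k ≤ -1.
  have htail : StatIncr.regularPart X m μ - δ ∈ StatIncr.stepPastSpace X μ (-1) := by
    refine (StatIncr.stepPastSpace_isClosed X μ (-1)).mem_of_tendsto
      ((hasSum_nat_add_iff' (m + 1)).2 (hφ.hasSum μ hμ m)) (Eventually.of_forall fun s => ?_)
    exact Submodule.sum_mem _ fun k _ => Submodule.smul_mem _ _ (hW.2 _ (by push_cast; omega))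
  have hstep : X m μ - δ ∈ StatIncr.stepPastSpace X μ (-1) := by
    rw [← StatIncr.singularPart_add_regularPart X m μ, add_sub_assoc]
    exact Submodule.add_mem _ (hW.1 m) htail
  have hpast := StatIncr.stepPastSpace_le_pastSpace hμ hstep
  have hperp : ∀ y ∈ StatIncr.pastSpace X (-1), inner ℂ y (X m μ - (X m μ - δ)) = 0 := by
    intro y hy
    rw [sub_sub_cancel, inner_sum]
    refine Finset.sum_eq_zero fun k hk => ?_
    have hk' := Finset.mem_range.1 hk
    rw [inner_smul_right, hinn.inner_pastSpace_eq_zero (by omega) hy, mul_zero]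
  have herr : StatIncr.meanSquareError (X m μ) (X m μ - δ) =
      ∑ k ∈ Finset.range (m + 1), ‖φ μ k‖ ^ 2 := by
    have hinj : Function.Injective fun k : ℕ => (m : ℤ) - k := fun i j h => by simpa using h
    rw [StatIncr.meanSquareError_eq, sub_sub_cancel, hδ]
    exact StatIncr.norm_sq_sum_of_orthonormal (hinn.orthonormal.comp _ hinj) _ _
  refine ⟨X m μ - δ, ?_, StatIncr.isOptimalEstimate_iff hpast hperp,
    StatIncr.isOptimalEstimate_iff hstep
      fun y hy => hperp y (StatIncr.stepPastSpace_le_pastSpace hμ hy), ?_, herr⟩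
  · rw [StatIncr.hasStochasticIntegral_iff hJZ hmem, hmap]
    exact sub_right_comm _ _ _
  · rw [herr, StatIncr.integral_norm_sq_trigonometricPolynomial]
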